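/- Let $n\in\mathbb N$, $\ell\ge 1$ and $0=\tau_0<\tau_1<\dots<\tau_\ell=:\Delta$. On $\mathbb R^n$ and on $\mathbb R^{(\ell+1)n}$ let $|\cdot|$ be the maximum norm. Let $\mathcal L^\infty$ be the set of Lebesgue measurable, essentially bounded functions $[-\Delta,0]\to\mathbb R^n$, let $L^\infty=L^\infty([-\Delta,0],\mathbb R^n)$ be the space of their classes modulo almost everywhere equality, with essential supremum norm $\|\cdot\|$, and write $\phi^k\rightharpoonup\phi^0$ for weak-* convergence of sequences in $L^\infty$ (tested against $L^1([-\Delta,0],\mathbb R^n)$). For $\phi\in\mathcal L^\infty$ (or a representative of an element of $L^\infty$) and $x$ defined from $t_0$ on, let $\phi\diamond_{t_0}x$ be the function equal to $\phi(t-t_0)$ for $t\in[t_0-\Delta,t_0)$ and to $x(t)$ for $t\ge t_0$. For a function $\mathsf x$ put $\mathsf x_t(s)=\mathsf x(t+s)$, $s\in[-\Delta,0]$, and $\mathsf x(t-\tau_{0:\ell})=(\mathsf x(t-\tau_0),\dots,\mathsf x(t-\tau_\ell))$. Let $f:\mathbb R_{\ge0}\times\mathbb R^{(\ell+1)n}\times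 L^\infty\to\mathbb R^n$ satisfy the following. 1. For all $R,T>0$ there are $L\ge 0$ and a null set $Z\subset\mathbb R_{\ge 0}$ with $|f(t,\xi,\phi)-f(t,\zeta,\psi)|\le L\max\{|\xi-\zeta|,\|\phi-\psi\|\}$ for all $t\in[0,T]\setminus Z$ and all $\xi,\zeta\in\mathbb R^{(\ell+1)n}$, $\phi,\psi\in L^\infty$ of norm at most $R$. 2. $f(\cdot,0,0)$ is locally essentially bounded. 3. For all $0\le t_0<T$, $\phi\in\mathcal L^\infty$ and continuous $x:[t_0,T]\to\mathbb R^n$, the function $t\mapsto f(t,\mathsf x(t-\tau_{0:\ell}),\mathsf x_t)$ on $[t_0,T]$, with $\mathsf x=\phi\diamond_{t_0}x$, is Lebesgue measurable. 4. For all $R,T>0$ there is a null set $Z\subset[0,T]$ such that for every $\varepsilon>0$ and every sequence $\phi^k\rightharpoonup\phi^0$ with $\|\phi^k\|\le R$ for all $k$ there is $j$ with $|f(t,\xi,\phi^k)-f(t,\xi,\phi^0)|<\varepsilon$ for all $t\in[0,T]\setminus Z$, $|\xi|\le R$ and $k\ge j$. 5. For all $t_0\ge0$, $R\ge0$, $\varepsilon>0$,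 continuous $x:[t_0,t_0+\Delta]\to\mathbb R^n$ with $|x|\le R$, and $\phi^k\rightharpoonup\phi^0$ with $\|\phi^k\|\le R$ for all $k$, there is $j$ such that for all $t\in[t_0,t_0+\Delta]$ and $k\ge j$ the following integral exists and satisfies $$\Big|\int_{t_0}^t\big[f(s,\mathsf x^k(s-\tau_{0:\ell}),\mathsf x^0_s)-f(s,\mathsf x^0(s-\tau_{0:\ell}),\mathsf x^0_s)\big]ds\Big|<\varepsilon,\qquad \mathsf x^k=\phi^k\diamond_{t_0}x.$$ Consider the system $\dot x(t)=f(t,\mathsf x(t-\tau_{0:\ell}),\mathsf x_t)$, $\mathsf x=\phi\diamond_{t_0}x$, $x(t_0)=\xi$, with $t_0\ge 0$ and initial condition $(\xi,\phi)\in\mathbb R^n\times L^\infty$. Its solutions are the locally absolutely continuous functions $x$ on intervals $[t_0,b)$ or $[t_0,b]$, $t_0<b\le\infty$, that satisfy the corresponding integral equation (they do not depend on the representative of $\phi$). Call the initial condition continuous if $\phi$ has a continuous representative on $[-\Delta,0]$ with value $\xi$ at $0$. The system is forward complete for a set of initial conditions if for every $t_0\ge0$ and every initial condition in the set the maximal solution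 is defined on $[t_0,\infty)$. It has bounded reachability sets for a set of initial conditions if it is forward complete for that set and, for all $0\le t_0<T$ and $R>0$, $\sup|x(t)|<\infty$, where the supremum is over $t\in[t_0,T]$ and all solutions $x$ with initial time $t_0$ and initial condition in the set with $|\xi|\le R$, $\|\phi\|\le R$. Then the system has bounded reachability sets for continuous initial conditions if and only if it is forward complete for all initial conditions in $\mathbb R^n\times L^\infty$. -/

import Mathlib

open MeasureTheory Set Filter Topology

noncomputable section

namespace DelaySystem

variable {n ℓ : ℕ}

/-- `ℝⁿ` with the infinity norm. -/
abbrev Vec (n : ℕ) : Type := Fin n → ℝ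

/-- Lebesgue measure on `[-Δ, 0]`. -/
abbrev histMeasure (Δ : ℝ) : Measure ℝ := volume.restrict (Icc (-Δ) 0)

/-- `L^∞([-Δ,0], ℝⁿ)`: equivalence classes of essentially bounded functions; its norm is the
essential supremum of the infinity norm. -/
abbrev LInf (n : ℕ) (Δ : ℝ) : Type := Lp (Vec n) ⊤ (histMeasure Δ)

/-- `φ` (restricted to `[-Δ,0]`) is Lebesgue measurable and essentially bounded, i.e. belongs to
the space of functions `𝓛^∞([-Δ,0], ℝⁿ)`. Values outside `[-Δ,0]` are irrelevant. -/
def MemCalLInf (Δ : ℝ) (φ : ℝ → Vec n) : Prop := MemLp φ ⊤ (histMeasure Δ)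

/-- The maximal delay `Δ = τ_ℓ` of a list of delays `τ_0, …, τ_ℓ`. -/
abbrev maxDelay (τ : Fin (ℓ + 1) → ℝ) : ℝ := τ (Fin.last ℓ)

/-- Right-hand sides `f(t, ξ_{0:ℓ}, φ)`. Only the values at times `t ≥ 0` are ever used. -/
abbrev RHS (n ℓ : ℕ) (Δ : ℝ) : Type :=
  ℝ → (Fin (ℓ + 1) → Vec n) → LInf n Δ → Vec n

/-- Concatenation of `φ` on `[t₀-Δ, t₀)` (shifted by `t₀`) with `x` from `t₀` on. -/
def concat (t₀ : ℝ) (φ x : ℝ → Vec n) : ℝ → Vec n :=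
  fun t => if t < t₀ then φ (t - t₀) else x t

open Classical in
/-- The class in `L^∞` of the history segment `s ↦ X (t + s)`, `s ∈ [-Δ,0]`. (The value `0` is
used if the segment is not in `𝓛^∞`, which never occurs for the trajectories considered.) -/
def segment (Δ : ℝ) (X : ℝ → Vec n) (t : ℝ) : LInf n Δ :=
  if h : MemLp (fun s => X (t + s)) ⊤ (histMeasure Δ) then h.toLp _ else 0

/-- The vector `(X (t - τ_0), …, X (t - τ_ℓ))`. -/
def delayed (τ : Fin (ℓ + 1) → ℝ) (X : ℝ → Vec n) (t : ℝ) : Fin (ℓ + 1) → Vec n :=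
  fun i => X (t - τ i)

/-- `t ↦ f (t, X(t - τ_{0:ℓ}), X_t)`. -/
def vectorField (τ : Fin (ℓ + 1) → ℝ) (f : RHS n ℓ (maxDelay τ)) (X : ℝ → Vec n) (t : ℝ) : Vec n :=
  f t (delayed τ X t) (segment (maxDelay τ) X t)

/-! ### Solutions -/

/-- Intervals `[a,b)` or `[a,b]` with `a < b ≤ ∞`. -/
def IsForwardInterval (a : ℝ) (J : Set ℝ) : Prop :=
  J = Ici a ∨ ∃ b, a < b ∧ (J = Ico a b ∨ J = Icc a b)

/-- `x : J → ℝⁿ` is a solution with initial time `t₀` and initial function `ψ`: it is locally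
absolutely continuous on `J` and satisfies the integral equation on `J`. Values of `x` outside `J`
are irrelevant. -/
structure IsSolution (τ : Fin (ℓ + 1) → ℝ) (f : RHS n ℓ (maxDelay τ)) (t₀ : ℝ) (ψ : ℝ → Vec n)
    (J : Set ℝ) (x : ℝ → Vec n) : Prop where
  interval : IsForwardInterval t₀ J
  absCont : ∀ t ∈ J, AbsolutelyContinuousOnInterval x t₀ t
  integrable : ∀ t ∈ J, IntervalIntegrable (vectorField τ f (concat t₀ ψ x)) volume t₀ t
  eq_integral : ∀ t ∈ J, x t = ψ 0 + ∫ s in t₀..t, vectorField τ f (concat t₀ ψ x) s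

/-- A solution that has no strict extension which is again a solution. -/
def IsMaximalSolution (τ : Fin (ℓ + 1) → ℝ) (f : RHS n ℓ (maxDelay τ)) (t₀ : ℝ) (ψ : ℝ → Vec n)
    (J : Set ℝ) (x : ℝ → Vec n) : Prop :=
  IsSolution τ f t₀ ψ J x ∧
    ∀ (J' : Set ℝ) (y : ℝ → Vec n), IsSolution τ f t₀ ψ J' y → J ⊆ J' → EqOn y x J → J' = J

/-- Maximal solution for an initial condition `(ξ, φ) ∈ ℝⁿ × L^∞`: a maximal solution for a
representative `ψ ∈ 𝓛^∞` of `φ` with `ψ(0) = ξ`. -/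
def IsMaximalSolutionFrom (τ : Fin (ℓ + 1) → ℝ) (f : RHS n ℓ (maxDelay τ)) (t₀ : ℝ) (ξ : Vec n)
    (φ : LInf n (maxDelay τ)) (J : Set ℝ) (x : ℝ → Vec n) : Prop :=
  ∃ ψ : ℝ → Vec n, MemCalLInf (maxDelay τ) ψ ∧ ψ =ᵐ[histMeasure (maxDelay τ)] φ ∧ ψ 0 = ξ ∧
    IsMaximalSolution τ f t₀ ψ J x

/-- The continuous initial conditions: pairs `(ξ, φ)` such that `φ` has a representative that is
continuous on `[-Δ,0]` and takes the value `ξ` at `0`. -/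
def continuousIC (n : ℕ) (Δ : ℝ) : Set (Vec n × LInf n Δ) :=
  {p | ∃ ψ : ℝ → Vec n, ContinuousOn ψ (Icc (-Δ) 0) ∧ ψ =ᵐ[histMeasure Δ] p.2 ∧ ψ 0 = p.1}

/-- Forward completeness for initial conditions in `S`: for every initial time `t₀ ≥ 0` and every
initial condition in `S`, there is a maximal solution and it is defined for all `t ≥ t₀`. -/
def ForwardCompleteOn (τ : Fin (ℓ + 1) → ℝ) (f : RHS n ℓ (maxDelay τ))
    (S : Set (Vec n × LInf n (maxDelay τ))) : Prop :=
  ∀ t₀ : ℝ, 0 ≤ t₀ → ∀ p ∈ S,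
    (∃ J x, IsMaximalSolutionFrom τ f t₀ p.1 p.2 J x) ∧
      ∀ J x, IsMaximalSolutionFrom τ f t₀ p.1 p.2 J x → J = Ici t₀

/-- Bounded reachability sets for initial conditions in `S`: solutions exist for all future times,
and for all `0 ≤ t₀ < T` and `R > 0` the solutions with `(ξ, φ) ∈ S`, `|ξ| ≤ R`, `‖φ‖ ≤ R` are
uniformly bounded on `[t₀, T]`. -/
def BoundedReachabilitySetsOn (τ : Fin (ℓ + 1) → ℝ) (f : RHS n ℓ (maxDelay τ))
    (S : Set (Vec n × LInf n (maxDelay τ))) : Prop :=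
  ForwardCompleteOn τ f S ∧
    ∀ t₀ T R : ℝ, 0 ≤ t₀ → t₀ < T → 0 < R →
      BddAbove {r : ℝ | ∃ p ∈ S, ‖p.1‖ ≤ R ∧ ‖p.2‖ ≤ R ∧
        ∃ J x, IsMaximalSolutionFrom τ f t₀ p.1 p.2 J x ∧ ∃ t ∈ Icc t₀ T ∩ J, r = ‖x t‖}

/-! ### Assumptions on the right-hand side -/

/-- Weak-* convergence in `L^∞([-Δ,0], ℝⁿ)` (as the dual of `L^1`). -/
def WeakStarTendsto {Δ : ℝ} (φ : ℕ → LInf n Δ) (φ₀ : LInf n Δ) : Prop :=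
  ∀ g : ℝ → Vec n, Integrable g (histMeasure Δ) →
    Tendsto (fun k => ∫ s in Icc (-Δ) 0, g s ⬝ᵥ φ k s) atTop
      (𝓝 (∫ s in Icc (-Δ) 0, g s ⬝ᵥ φ₀ s))

/-- The basic regularity assumption (Lipschitz on bounded sets, locally essentially bounded at
zero, measurable along trajectories), with constants uniform over the family `F`. -/
structure UniformlyRegular (τ : Fin (ℓ + 1) → ℝ) (F : Set (RHS n ℓ (maxDelay τ))) : Prop where
  lipschitz : ∀ R T : ℝ, 0 < R → 0 < T → ∃ L : ℝ, 0 ≤ L ∧ ∀ f ∈ F, ∃ Z : Set ℝ, volume Z = 0 ∧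
    ∀ (ξ ζ : Fin (ℓ + 1) → Vec n) (φ ψ : LInf n (maxDelay τ)),
      ‖ξ‖ ≤ R → ‖ζ‖ ≤ R → ‖φ‖ ≤ R → ‖ψ‖ ≤ R → ∀ t ∈ Icc 0 T \ Z,
        ‖f t ξ φ - f t ζ ψ‖ ≤ L * max ‖ξ - ζ‖ ‖φ - ψ‖
  bounded_zero : ∀ T : ℝ, 0 < T → ∃ C : ℝ, ∀ f ∈ F, ∀ᵐ t ∂(volume.restrict (Icc 0 T)),
    ‖f t 0 0‖ ≤ C
  measurable : ∀ f ∈ F, ∀ t₀ T : ℝ, 0 ≤ t₀ → t₀ < T → ∀ φ x : ℝ → Vec n,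
    MemCalLInf (maxDelay τ) φ → ContinuousOn x (Icc t₀ T) →
      AEStronglyMeasurable (vectorField τ f (concat t₀ φ x)) (volume.restrict (Icc t₀ T))

/-- The main assumption on a family `F` of right-hand sides. The exceptional null sets in
`weakStar_cont` depend only on `T`, `R` and `f`. In `discrete_cont` the condition includes that
the integral makes sense. -/
structure WeakStarRegular (τ : Fin (ℓ + 1) → ℝ) (F : Set (RHS n ℓ (maxDelay τ))) : Prop where
  regular : UniformlyRegular τ F
  weakStar_cont : ∀ T R : ℝ, 0 < T → 0 < R →
    ∃ Z : RHS n ℓ (maxDelay τ) → Set ℝ, (∀ f ∈ F, volume (Z f) = 0) ∧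
      ∀ (ε : ℝ) (φ : ℕ → LInf n (maxDelay τ)) (φ₀ : LInf n (maxDelay τ)), 0 < ε →
        (∀ k, ‖φ k‖ ≤ R) → WeakStarTendsto φ φ₀ →
        ∃ j : ℕ, ∀ f ∈ F, ∀ t ∈ Icc 0 T \ Z f, ∀ ξ : Fin (ℓ + 1) → Vec n, ‖ξ‖ ≤ R →
          ∀ k ≥ j, ‖f t ξ (φ k) - f t ξ φ₀‖ < ε
  discrete_cont : ∀ (t₀ R ε : ℝ) (x : ℝ → Vec n) (φ : ℕ → LInf n (maxDelay τ))
    (φ₀ : LInf n (maxDelay τ)), 0 ≤ t₀ → 0 ≤ R → 0 < ε →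
    ContinuousOn x (Icc t₀ (t₀ + maxDelay τ)) → (∀ t ∈ Icc t₀ (t₀ + maxDelay τ), ‖x t‖ ≤ R) →
    (∀ k, ‖φ k‖ ≤ R) → WeakStarTendsto φ φ₀ →
    ∃ j : ℕ, ∀ f ∈ F, ∀ t ∈ Icc t₀ (t₀ + maxDelay τ), ∀ k ≥ j,
      let X₀ : ℝ → Vec n := concat t₀ φ₀ x
      let X : ℝ → Vec n := concat t₀ (φ k) x
      let h : ℝ → Vec n := fun s =>
        f s (delayed τ X s) (segment (maxDelay τ) X₀ s) -
          f s (delayed τ X₀ s) (segment (maxDelay τ) X₀ s)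
      IntervalIntegrable h volume t₀ t ∧ ‖∫ s in t₀..t, h s‖ < ε

end DelaySystem

end

namespace DelaySystem

variable {n ℓ : ℕ}

/-! Both directions rest on one continuity statement. If histories converge weak-* while the
continuation is kept fixed on one delay window `[a, a + Δ]`, then the integrated vector fields
converge uniformly (`WeakStarRegular.tendsto_integral`). Exchanging the discrete arguments is
covered by `discrete_cont`; exchanging the distributed argument follows from `weakStar_cont` and
dominated convergence, because segments inherit weak-* convergence. The estimate `exists_gronwall`
then compares different continuations of the same history.

Suppose all initial conditions give global solutions, but solutions with bounded data are unbounded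
on one window. By `exists_subseq_weakStarTendsto` the data have a convergent subsequence, weak-* in
the history. The limit datum may be discontinuous, which is why completeness is needed on all of `ℝⁿ
× L^∞`. Its solution is bounded on the window, and a bootstrap keeps solutions far along the
subsequence within distance `1` of it: a contradiction (`exists_bound_maxDelay`). Induction over
windows reaches every time.

Conversely, approximate a history by continuous ones with the same bound and the same value at `0`.
Bounded reachability makes their solutions uniformly bounded on the window, hence equi-Lipschitz,
and an Arzelà–Ascoli limit solves the equation for the original history
(`SolvesOn.of_tendstoUniformlyOn`). At `a + Δ` the past of this solution is continuous, so forward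
completeness for continuous data continues it to all later times. -/

/-! ### Essentially bounded trajectories, segments and concatenation -/

/-- `X` is measurable on `[a,b]` and bounded by `R` almost everywhere there. -/
structure EssBddOn (a b R : ℝ) (X : ℝ → Vec n) : Prop where
  aesm : AEStronglyMeasurable X (volume.restrict (Icc a b))
  bound : ∀ᵐ r ∂volume.restrict (Icc a b), ‖X r‖ ≤ R

theorem EssBddOn.mono {a b c d R S : ℝ} {X : ℝ → Vec n} (h : EssBddOn a b R X)
    (hca : a ≤ c) (hdb : d ≤ b) (hRS : R ≤ S) : EssBddOn c d S X :=
  ⟨h.aesm.mono_measure (Measure.restrict_mono (Icc_subset_Icc hca hdb) le_rfl),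
    (ae_restrict_of_ae_restrict_of_subset (Icc_subset_Icc hca hdb) h.bound).mono
      fun _ hr => hr.trans hRS⟩

theorem measurePreserving_translate (Δ t : ℝ) :
    MeasurePreserving (fun s => t + s) (histMeasure Δ) (volume.restrict (Icc (t - Δ) t)) := by
  have h := (measurePreserving_add_left volume t).restrict_preimage
    (measurableSet_Icc (a := t - Δ) (b := t))
  have e : (fun x => t + x) ⁻¹' Icc (t - Δ) t = Icc (-Δ) 0 := by
    rw [preimage_const_add_Icc]; congr 1 <;> ring
  rwa [e] at h

theorem ae_restrict_sub {a b c d τ : ℝ} {P : ℝ → Prop} (h : ∀ᵐ r ∂volume.restrict (Icc c d), P r)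
    (hc : c ≤ a - τ) (hd : b - τ ≤ d) : ∀ᵐ s ∂volume.restrict (Icc a b), P (s - τ) := by
  have hp := (measurePreserving_sub_right volume τ).restrict_preimage
    (measurableSet_Icc (a := c) (b := d))
  rw [preimage_sub_const_Icc] at hp
  exact ae_restrict_of_ae_restrict_of_subset
    (Icc_subset_Icc (by linarith) (by linarith)) (hp.quasiMeasurePreserving.ae h)

theorem ae_histMeasure_of_ae_restrict {Δ t : ℝ} {P : ℝ → Prop}
    (h : ∀ᵐ r ∂volume.restrict (Icc (t - Δ) t), P r) : ∀ᵐ s ∂histMeasure Δ, P (t + s) :=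
  (measurePreserving_translate Δ t).quasiMeasurePreserving.ae h

theorem ae_norm_le_norm {Δ : ℝ} (φ : LInf n Δ) : ∀ᵐ s ∂histMeasure Δ, ‖φ s‖ ≤ ‖φ‖ := by
  have h := ae_le_eLpNormEssSup (f := φ) (μ := histMeasure Δ)
  filter_upwards [h] with s hs
  rw [Lp.norm_def, eLpNorm_exponent_top, ← toReal_enorm]
  refine ENNReal.toReal_mono ?_ hs
  have := Lp.eLpNorm_ne_top φ
  rwa [eLpNorm_exponent_top] at this

theorem norm_le_of_ae_le {Δ C : ℝ} (φ : LInf n Δ) (hC : 0 ≤ C)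
    (h : ∀ᵐ s ∂histMeasure Δ, ‖φ s‖ ≤ C) : ‖φ‖ ≤ C := by
  simpa using Lp.norm_le_of_ae_bound hC h

theorem EssBddOn.memLp_segment {Δ t R : ℝ} {X : ℝ → Vec n} (h : EssBddOn (t - Δ) t R X) :
    MemLp (fun s => X (t + s)) ⊤ (histMeasure Δ) :=
  memLp_top_of_bound (h.aesm.comp_measurePreserving (measurePreserving_translate Δ t)) R
    (ae_histMeasure_of_ae_restrict h.bound)

theorem EssBddOn.coeFn_segment {Δ t R : ℝ} {X : ℝ → Vec n} (h : EssBddOn (t - Δ) t R X) :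
    segment Δ X t =ᵐ[histMeasure Δ] fun s => X (t + s) := by
  rw [segment, dif_pos h.memLp_segment]
  exact MemLp.coeFn_toLp _

theorem segment_congr {Δ t : ℝ} {X Y : ℝ → Vec n}
    (h : ∀ᵐ r ∂volume.restrict (Icc (t - Δ) t), X r = Y r) : segment Δ X t = segment Δ Y t := by
  have h' : (fun s => X (t + s)) =ᵐ[histMeasure Δ] fun s => Y (t + s) :=
    ae_histMeasure_of_ae_restrict h
  unfold segment
  by_cases hX : MemLp (fun s => X (t + s)) ⊤ (histMeasure Δ)
  · have hY := (memLp_congr_ae h').1 hX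
    rw [dif_pos hX, dif_pos hY]
    exact (MemLp.toLp_eq_toLp_iff hX hY).2 h'
  · rw [dif_neg hX, dif_neg fun hY => hX ((memLp_congr_ae h').2 hY)]

theorem EssBddOn.norm_segment_le {Δ t R : ℝ} {X : ℝ → Vec n} (hR : 0 ≤ R)
    (h : EssBddOn (t - Δ) t R X) : ‖segment Δ X t‖ ≤ R := by
  refine norm_le_of_ae_le _ hR ?_
  filter_upwards [h.coeFn_segment, ae_histMeasure_of_ae_restrict h.bound] with s h1 h2
  rwa [h1]

theorem norm_segment_sub_le {Δ t R K : ℝ} {X Y : ℝ → Vec n} (hK : 0 ≤ K)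
    (hX : EssBddOn (t - Δ) t R X) (hY : EssBddOn (t - Δ) t R Y)
    (h : ∀ᵐ r ∂volume.restrict (Icc (t - Δ) t), ‖X r - Y r‖ ≤ K) :
    ‖segment Δ X t - segment Δ Y t‖ ≤ K := by
  refine norm_le_of_ae_le _ hK ?_
  filter_upwards [hX.coeFn_segment, hY.coeFn_segment, ae_histMeasure_of_ae_restrict h,
    Lp.coeFn_sub (segment Δ X t) (segment Δ Y t)] with s h1 h2 h3 h4
  rwa [h4, Pi.sub_apply, h1, h2]

theorem essBddOn_coeFn {Δ R : ℝ} (φ : LInf n Δ) (h : ‖φ‖ ≤ R) : EssBddOn (-Δ) 0 R φ :=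
  ⟨Lp.aestronglyMeasurable φ, (ae_norm_le_norm φ).mono fun _ hs => hs.trans h⟩

theorem EssBddOn.congr {a b R : ℝ} {X Y : ℝ → Vec n} (h : EssBddOn a b R X)
    (hXY : X =ᵐ[volume.restrict (Icc a b)] Y) : EssBddOn a b R Y :=
  ⟨h.aesm.congr hXY, by filter_upwards [h.bound, hXY] with r h1 h2; rwa [← h2]⟩

theorem essBddOn_of_ae_eq {Δ R : ℝ} {φ : LInf n Δ} {ψ : ℝ → Vec n}
    (hψ : ψ =ᵐ[histMeasure Δ] φ) (h : ‖φ‖ ≤ R) : EssBddOn (-Δ) 0 R ψ :=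
  (essBddOn_coeFn φ h).congr hψ.symm

theorem EssBddOn.memCalLInf {Δ R : ℝ} {ψ : ℝ → Vec n} (h : EssBddOn (-Δ) 0 R ψ) :
    MemCalLInf Δ ψ :=
  memLp_top_of_bound h.aesm R h.bound

theorem concat_of_ge {a t : ℝ} {ψ x : ℝ → Vec n} (h : a ≤ t) : concat a ψ x t = x t :=
  if_neg h.not_gt

theorem concat_of_lt {a t : ℝ} {ψ x : ℝ → Vec n} (h : t < a) : concat a ψ x t = ψ (t - a) :=
  if_pos h

theorem ae_restrict_concat {a b Δ : ℝ} {P : ℝ → Prop}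
    (h₁ : ∀ᵐ r ∂volume.restrict (Icc (a - Δ) a), r < a → P r) (h₂ : ∀ t ∈ Icc a b, P t) :
    ∀ᵐ r ∂volume.restrict (Icc (a - Δ) b), P r := by
  rw [ae_restrict_iff' measurableSet_Icc] at h₁ ⊢
  filter_upwards [h₁] with r h1 hr
  rcases lt_or_ge r a with h | h
  · exact h1 ⟨hr.1, h.le⟩ h
  · exact h₂ r ⟨h, hr.2⟩

theorem ae_restrict_of_histMeasure {a Δ : ℝ} {P : ℝ → Prop} (h : ∀ᵐ s ∂histMeasure Δ, P s) :
    ∀ᵐ r ∂volume.restrict (Icc (a - Δ) a), P (r - a) :=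
  ae_restrict_sub h (by linarith) (by linarith)

theorem concat_congr_ae {a Δ b : ℝ} {ψ ψ' x y : ℝ → Vec n} (h : ψ =ᵐ[histMeasure Δ] ψ')
    (hxy : EqOn x y (Icc a b)) :
    ∀ᵐ r ∂volume.restrict (Icc (a - Δ) b), concat a ψ x r = concat a ψ' y r := by
  refine ae_restrict_concat ?_ fun t ht => ?_
  · filter_upwards [ae_restrict_of_histMeasure h] with r hr hra
    rw [concat_of_lt hra, concat_of_lt hra, hr]
  · rw [concat_of_ge ht.1, concat_of_ge ht.1, hxy ht]

theorem EssBddOn.concat {a b Δ R : ℝ} {ψ x : ℝ → Vec n} (hψ : EssBddOn (-Δ) 0 R ψ)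
    (hx : ContinuousOn x (Icc a b)) (hxR : ∀ t ∈ Icc a b, ‖x t‖ ≤ R) :
    EssBddOn (a - Δ) b R (concat a ψ x) := by
  constructor
  · have h : AEStronglyMeasurable (DelaySystem.concat a ψ x)
        (volume.restrict (Icc (a - Δ) a ∪ Icc a b)) := by
      rw [aestronglyMeasurable_union_iff]
      constructor
      · have hp := (measurePreserving_sub_right volume a).restrict_preimage
          (measurableSet_Icc (a := -Δ) (b := 0))
        have e : (fun x => x - a) ⁻¹' Icc (-Δ) 0 = Icc (a - Δ) a := by
          rw [preimage_sub_const_Icc]; congr 1 <;> ring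
        rw [e] at hp
        refine (hψ.aesm.comp_measurePreserving hp).congr ?_
        have hne : ∀ᵐ r ∂volume.restrict (Icc (a - Δ) a), r ≠ a :=
          ae_restrict_of_ae (by simp [ae_iff, measure_singleton])
        filter_upwards [hne, ae_restrict_mem measurableSet_Icc] with r h1 h2
        exact (concat_of_lt (lt_of_le_of_ne h2.2 h1)).symm
      · refine (hx.aestronglyMeasurable measurableSet_Icc).congr ?_
        filter_upwards [ae_restrict_mem measurableSet_Icc] with r h2
        exact (concat_of_ge h2.1).symm
    refine h.mono_measure (Measure.restrict_mono (fun r hr => ?_) le_rfl)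
    rcases le_total r a with h | h
    · exact Or.inl ⟨hr.1, h⟩
    · exact Or.inr ⟨h, hr.2⟩
  · refine ae_restrict_concat ?_ fun t ht => ?_
    · filter_upwards [ae_restrict_of_histMeasure hψ.bound] with r hr hra
      rwa [concat_of_lt hra]
    · rw [concat_of_ge ht.1]; exact hxR t ht

/-- Makes restarting possible: with its own past as history, the trajectory is the same function, so
its vector field is unchanged. Shifting and gluing of solutions rest on this. -/
theorem concat_shift {a t₁ : ℝ} (h : a ≤ t₁) (ψ x : ℝ → Vec n) :
    concat t₁ (fun s => concat a ψ x (t₁ + s)) x = concat a ψ x := by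
  funext r
  rcases lt_or_ge r t₁ with hr | hr
  · rw [concat_of_lt hr]; congr 1; ring
  · rw [concat_of_ge hr, concat_of_ge (h.trans hr)]

/-! ### Estimates for the vector field -/

variable {τ : Fin (ℓ + 1) → ℝ} {f : RHS n ℓ (maxDelay τ)}

theorem delay_nonneg (hτ0 : τ 0 = 0) (hτ : StrictMono τ) (i : Fin (ℓ + 1)) : 0 ≤ τ i :=
  hτ0 ▸ hτ.monotone (Fin.zero_le i)

theorem delay_le (hτ : StrictMono τ) (i : Fin (ℓ + 1)) : τ i ≤ maxDelay τ :=
  hτ.monotone (Fin.le_last i)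

theorem maxDelay_pos (hℓ : 1 ≤ ℓ) (hτ0 : τ 0 = 0) (hτ : StrictMono τ) : 0 < maxDelay τ := by
  rw [← hτ0]
  refine hτ (Fin.lt_def.2 ?_)
  simp; omega

theorem ae_delayed (hτ0 : τ 0 = 0) (hτ : StrictMono τ) {a b : ℝ} {P : ℝ → Prop}
    (h : ∀ᵐ r ∂volume.restrict (Icc (a - maxDelay τ) b), P r) :
    ∀ᵐ s ∂volume.restrict (Icc a b), ∀ i, P (s - τ i) :=
  ae_all_iff.2 fun i => ae_restrict_sub h (by linarith [delay_le hτ i])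
    (by linarith [delay_nonneg hτ0 hτ i])

theorem vectorField_congr (hτ0 : τ 0 = 0) (hτ : StrictMono τ) {a b : ℝ} {X Y : ℝ → Vec n}
    (h : ∀ᵐ r ∂volume.restrict (Icc (a - maxDelay τ) b), X r = Y r) :
    ∀ᵐ s ∂volume.restrict (Icc a b), vectorField τ f X s = vectorField τ f Y s := by
  filter_upwards [ae_delayed hτ0 hτ h, ae_restrict_mem measurableSet_Icc] with s h1 h2
  have e : delayed τ X s = delayed τ Y s := funext h1
  rw [vectorField, vectorField, e, segment_congr
    (ae_restrict_of_ae_restrict_of_subset (Icc_subset_Icc (by linarith [h2.1]) h2.2) h)]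

theorem norm_delayed_le {X : ℝ → Vec n} {s R : ℝ} (hR : 0 ≤ R) (h : ∀ i, ‖X (s - τ i)‖ ≤ R) :
    ‖delayed τ X s‖ ≤ R :=
  (pi_norm_le_iff_of_nonneg hR).2 h

theorem norm_delayed_sub_le {X Y : ℝ → Vec n} {s K : ℝ} (hK : 0 ≤ K)
    (h : ∀ i, ‖X (s - τ i) - Y (s - τ i)‖ ≤ K) : ‖delayed τ X s - delayed τ Y s‖ ≤ K :=
  (pi_norm_le_iff_of_nonneg hK).2 h

/-- Trajectories that are bounded by `R` up to time `T` have vector fields bounded by a constant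
that depends on `R` and `T` only. -/
theorem exists_vectorField_bound (hτ0 : τ 0 = 0) (hτ : StrictMono τ)
    (hf : UniformlyRegular τ {f}) {R T : ℝ} (hR : 0 < R) (hT : 0 < T) :
    ∃ C : ℝ, 0 ≤ C ∧ ∀ (X : ℝ → Vec n) (a b : ℝ), 0 ≤ a → b ≤ T →
      EssBddOn (a - maxDelay τ) b R X →
      ∀ᵐ s ∂volume.restrict (Icc a b), ‖vectorField τ f X s‖ ≤ C := by
  obtain ⟨L, hL, hlip⟩ := hf.lipschitz R T hR hT
  obtain ⟨Z, hZ, hlip⟩ := hlip f rfl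
  obtain ⟨C, hC⟩ := hf.bounded_zero T hT
  refine ⟨|C| + L * R, by positivity, fun X a b ha hb hX => ?_⟩
  have hZ' : ∀ᵐ s ∂volume.restrict (Icc a b), s ∉ Z :=
    ae_restrict_of_ae (measure_eq_zero_iff_ae_notMem.1 hZ)
  have h0 := ae_restrict_of_ae_restrict_of_subset (Icc_subset_Icc ha hb) (hC f rfl)
  filter_upwards [hZ', h0, ae_delayed hτ0 hτ hX.bound, ae_restrict_mem measurableSet_Icc]
    with s h1 h2 h3 h4
  have hd := norm_delayed_le hR.le h3
  have hs : ‖segment (maxDelay τ) X s‖ ≤ R :=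
    (hX.mono (by linarith [h4.1]) h4.2 le_rfl).norm_segment_le hR.le
  have key := hlip (delayed τ X s) 0 (segment (maxDelay τ) X s) 0 hd (by simpa using hR.le) hs
    (by simpa using hR.le) s ⟨⟨ha.trans h4.1, h4.2.trans hb⟩, h1⟩
  rw [sub_zero, sub_zero] at key
  have key2 : ‖vectorField τ f X s - f s 0 0‖ ≤ L * R :=
    key.trans (mul_le_mul_of_nonneg_left (max_le hd hs) hL)
  calc ‖vectorField τ f X s‖ = ‖f s 0 0 + (vectorField τ f X s - f s 0 0)‖ := by
        rw [add_sub_cancel]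
    _ ≤ ‖f s 0 0‖ + ‖vectorField τ f X s - f s 0 0‖ := norm_add_le _ _
    _ ≤ |C| + L * R := add_le_add (h2.trans (le_abs_self C)) key2

/-- At time `s` the vector field looks only at times up to `s`, so a monotone bound `κ` controls all
its arguments by `κ s`. Gronwall uses an exponential `κ`, the passage to a uniform limit a constant
one. -/
theorem exists_vectorField_lipschitz (hτ0 : τ 0 = 0) (hτ : StrictMono τ)
    (hf : UniformlyRegular τ {f}) {R T : ℝ} (hR : 0 < R) (hT : 0 < T) :
    ∃ L : ℝ, 0 < L ∧ ∀ (X Y : ℝ → Vec n) (κ : ℝ → ℝ) (a b : ℝ), 0 ≤ a → b ≤ T →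
      EssBddOn (a - maxDelay τ) b R X → EssBddOn (a - maxDelay τ) b R Y → Monotone κ →
      (∀ r, 0 ≤ κ r) → (∀ᵐ r ∂volume.restrict (Icc (a - maxDelay τ) b), ‖X r - Y r‖ ≤ κ r) →
      ∀ᵐ s ∂volume.restrict (Icc a b), ‖vectorField τ f X s - vectorField τ f Y s‖ ≤ L * κ s := by
  obtain ⟨L, hL, hlip⟩ := hf.lipschitz R T hR hT
  obtain ⟨Z, hZ, hlip⟩ := hlip f rfl
  refine ⟨L + 1, by positivity, fun X Y κ a b ha hb hX hY hκ hκ0 hXY => ?_⟩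
  have hZ' : ∀ᵐ s ∂volume.restrict (Icc a b), s ∉ Z :=
    ae_restrict_of_ae (measure_eq_zero_iff_ae_notMem.1 hZ)
  filter_upwards [hZ', ae_delayed hτ0 hτ hX.bound, ae_delayed hτ0 hτ hY.bound,
    ae_delayed hτ0 hτ hXY, ae_restrict_mem measurableSet_Icc] with s h1 h2 h3 h4 h5
  have hX' := hX.mono (c := s - maxDelay τ) (d := s) (by linarith [h5.1]) h5.2 le_rfl
  have hY' := hY.mono (c := s - maxDelay τ) (d := s) (by linarith [h5.1]) h5.2 le_rfl
  have key := hlip (delayed τ X s) (delayed τ Y s) (segment (maxDelay τ) X s)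
    (segment (maxDelay τ) Y s) (norm_delayed_le hR.le h2) (norm_delayed_le hR.le h3)
    (hX'.norm_segment_le hR.le) (hY'.norm_segment_le hR.le) s
    ⟨⟨ha.trans h5.1, h5.2.trans hb⟩, h1⟩
  refine key.trans (mul_le_mul (by linarith) (max_le ?_ ?_) (by positivity) (by positivity))
  · exact norm_delayed_sub_le (hκ0 s) fun i =>
      (h4 i).trans (hκ (by linarith [delay_nonneg hτ0 hτ i]))
  · refine norm_segment_sub_le (hκ0 s) hX' hY' ?_
    filter_upwards [ae_restrict_of_ae_restrict_of_subset
      (Icc_subset_Icc (by linarith [h5.1]) h5.2) hXY, ae_restrict_mem measurableSet_Icc] with r h6 h7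
    exact h6.trans (hκ h7.2)

theorem intervalIntegrable_of_bound {g : ℝ → Vec n} {a b C : ℝ}
    (hg : AEStronglyMeasurable g (volume.restrict (Icc a b)))
    (hC : ∀ᵐ s ∂volume.restrict (Icc a b), ‖g s‖ ≤ C) (hab : a ≤ b) :
    IntervalIntegrable g volume a b := by
  rw [intervalIntegrable_iff_integrableOn_Icc_of_le hab]
  exact IntegrableOn.of_bound measure_Icc_lt_top hg C hC

theorem intervalIntegrable_vectorField (hτ0 : τ 0 = 0) (hτ : StrictMono τ)
    (hf : UniformlyRegular τ {f}) {R a b : ℝ} {ψ x : ℝ → Vec n} (ha : 0 ≤ a) (hab : a ≤ b)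
    (hψ : EssBddOn (-maxDelay τ) 0 R ψ) (hx : ContinuousOn x (Icc a b)) :
    IntervalIntegrable (vectorField τ f (concat a ψ x)) volume a b := by
  rcases hab.eq_or_lt with rfl | hab
  · simp
  obtain ⟨M, hM⟩ := isCompact_Icc.exists_bound_of_continuousOn hx
  have hX : EssBddOn (a - maxDelay τ) b (max 1 (max R M)) (concat a ψ x) :=
    (hψ.mono le_rfl le_rfl (by simp)).concat hx fun t ht => (hM t ht).trans (by simp)
  obtain ⟨C, -, hC⟩ := exists_vectorField_bound hτ0 hτ hf
    (lt_of_lt_of_le one_pos (le_max_left 1 (max R M))) (ha.trans_lt hab)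
  exact intervalIntegrable_of_bound (hf.measurable f rfl a b ha hab ψ x hψ.memCalLInf hx)
    (hC _ a b ha le_rfl hX) hab.le

/-- The rate `2 * L` against the Lipschitz constant `L` produces the factor `1 / 2` that lets
Gronwall absorb the integral term. -/
theorem integral_exp_weight (L K a t : ℝ) :
    ∫ s in a..t, L * (K * Real.exp (2 * L * (s - a))) =
      K / 2 * (Real.exp (2 * L * (t - a)) - 1) := by
  have hd : ∀ s ∈ uIcc a t, HasDerivAt (fun s => K / 2 * Real.exp (2 * L * (s - a)))
      (L * (K * Real.exp (2 * L * (s - a)))) s := fun s _ => by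
    have h1 : HasDerivAt (fun s => 2 * L * (s - a)) (2 * L) s := by
      simpa using ((hasDerivAt_id s).sub_const a).const_mul (2 * L)
    convert! h1.exp.const_mul (K / 2) using 1
    ring
  rw [intervalIntegral.integral_eq_sub_of_hasDerivAt hd
    (Continuous.intervalIntegrable (by fun_prop) _ _)]
  simp; ring

/-- A Gronwall type estimate for two continuations of the same history. -/
theorem exists_gronwall (hτ0 : τ 0 = 0) (hτ : StrictMono τ)
    (hf : UniformlyRegular τ {f}) {R T : ℝ} (hR : 0 < R) (hT : 0 < T) :
    ∃ C : ℝ, 0 < C ∧ ∀ (ψ x y : ℝ → Vec n) (a b δ : ℝ), 0 ≤ a → b ≤ T → 0 ≤ δ →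
      EssBddOn (-maxDelay τ) 0 R ψ → ContinuousOn x (Icc a b) → ContinuousOn y (Icc a b) →
      (∀ t ∈ Icc a b, ‖x t‖ ≤ R) → (∀ t ∈ Icc a b, ‖y t‖ ≤ R) →
      (∀ t ∈ Icc a b, ‖x t - y t‖ ≤ δ + ‖∫ s in a..t,
        (vectorField τ f (concat a ψ x) s - vectorField τ f (concat a ψ y) s)‖) →
      ∀ t ∈ Icc a b, ‖x t - y t‖ ≤ C * δ := by
  obtain ⟨L, hL, hlip⟩ := exists_vectorField_lipschitz hτ0 hτ hf hR hT
  refine ⟨2 * Real.exp (2 * L * T), by positivity,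
    fun ψ x y a b δ ha hb hδ hψ hx hy hxR hyR H t ht => ?_⟩
  have hab : a ≤ b := ht.1.trans ht.2
  -- The difference is measured in an exponentially weighted maximum norm; its value `K`, attained
  -- at `c`, will be estimated by itself.
  have hq : ContinuousOn (fun t => ‖x t - y t‖ * Real.exp (-(2 * L * (t - a)))) (Icc a b) :=
    (hx.sub hy).norm.mul (by fun_prop)
  obtain ⟨c, hc, hmax⟩ := isCompact_Icc.exists_isMaxOn (nonempty_Icc.2 hab) hq
  set K := ‖x c - y c‖ * Real.exp (-(2 * L * (c - a))) with hK
  have hK0 : 0 ≤ K := by positivity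
  have hle : ∀ r ∈ Icc a b, ‖x r - y r‖ ≤ K * Real.exp (2 * L * (r - a)) := fun r hr => by
    have h1 : ‖x r - y r‖ * Real.exp (-(2 * L * (r - a))) ≤ K := hmax hr
    calc ‖x r - y r‖ = ‖x r - y r‖ * Real.exp (-(2 * L * (r - a))) * Real.exp (2 * L * (r - a)) := by
          rw [mul_assoc, ← Real.exp_add]; simp
      _ ≤ _ := mul_le_mul_of_nonneg_right h1 (Real.exp_pos _).le
  have hvf := hlip (concat a ψ x) (concat a ψ y) (fun r => K * Real.exp (2 * L * (r - a))) a b ha hb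
    (hψ.concat hx hxR) (hψ.concat hy hyR)
    (fun r s hrs => mul_le_mul_of_nonneg_left (Real.exp_le_exp.2 (by nlinarith)) hK0)
    (fun r => by positivity) (by
      refine ae_restrict_concat ?_ fun r hr => ?_
      · refine Eventually.of_forall fun r hr => ?_
        rw [concat_of_lt hr, concat_of_lt hr, sub_self, norm_zero]
        positivity
      · rw [concat_of_ge hr.1, concat_of_ge hr.1]; exact hle r hr)
  have hint : ∀ r ∈ Icc a b, ‖x r - y r‖ ≤ δ + K / 2 * (Real.exp (2 * L * (r - a)) - 1) := by
    intro r hr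
    refine (H r hr).trans (add_le_add le_rfl ?_)
    rw [← integral_exp_weight]
    refine intervalIntegral.norm_integral_le_of_norm_le hr.1 ?_
      (Continuous.intervalIntegrable (by fun_prop) _ _)
    filter_upwards [(ae_restrict_iff' measurableSet_Icc).1 hvf] with s hs hs'
    exact hs ⟨hs'.1.le, hs'.2.trans hr.2⟩
  -- At the maximizer, the integral inequality times the weight yields `K ≤ δ + K / 2`.
  have hKδ : K ≤ 2 * δ := by
    have h1 := hint c hc
    have he : Real.exp (-(2 * L * (c - a))) ≤ 1 :=
      Real.exp_le_one_iff.2 (by have := mul_nonneg hL.le (sub_nonneg.2 hc.1); linarith)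
    have hmul : Real.exp (2 * L * (c - a)) * Real.exp (-(2 * L * (c - a))) = 1 := by
      rw [← Real.exp_add]; simp
    have h2 : K ≤ (δ + K / 2 * (Real.exp (2 * L * (c - a)) - 1)) *
        Real.exp (-(2 * L * (c - a))) := mul_le_mul_of_nonneg_right h1 (Real.exp_pos _).le
    have h3 := mul_le_mul_of_nonneg_left he hδ
    have h4 : 0 ≤ K / 2 * Real.exp (-(2 * L * (c - a))) := by positivity
    linear_combination 2 * h2 + 2 * h3 + K * hmul + 2 * h4
  have hexp : Real.exp (2 * L * (t - a)) ≤ Real.exp (2 * L * T) :=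
    Real.exp_le_exp.2 (by nlinarith [ht.2])
  calc ‖x t - y t‖ ≤ K * Real.exp (2 * L * (t - a)) := hle t ht
    _ ≤ (2 * δ) * Real.exp (2 * L * T) := mul_le_mul hKδ hexp (Real.exp_pos _).le (by positivity)
    _ = _ := by ring

/-! ### Integral form of solutions: uniqueness, maximality, gluing -/

/-- `x` is continuous on `[a,b]` and satisfies the integral equation with history `ψ` there. -/
structure SolvesOn (τ : Fin (ℓ + 1) → ℝ) (f : RHS n ℓ (maxDelay τ)) (a b : ℝ)
    (ψ x : ℝ → Vec n) : Prop where
  cont : ContinuousOn x (Icc a b)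
  eq_integral : ∀ t ∈ Icc a b, x t = ψ 0 + ∫ s in a..t, vectorField τ f (concat a ψ x) s

theorem SolvesOn.mono {a b c : ℝ} {ψ x : ℝ → Vec n} (h : SolvesOn τ f a b ψ x) (hcb : c ≤ b) :
    SolvesOn τ f a c ψ x :=
  ⟨h.cont.mono (Icc_subset_Icc le_rfl hcb), fun t ht => h.eq_integral t ⟨ht.1, ht.2.trans hcb⟩⟩

theorem SolvesOn.apply_left {a b : ℝ} {ψ x : ℝ → Vec n} (h : SolvesOn τ f a b ψ x) (hab : a ≤ b) :
    x a = ψ 0 := by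
  simpa using h.eq_integral a ⟨le_rfl, hab⟩

/-- A change of representative alters the vector field only on a null set of times. The value at `0`
enters the equation on its own and must be matched separately. -/
theorem SolvesOn.congr (hτ0 : τ 0 = 0) (hτ : StrictMono τ) {a b : ℝ} {ψ ψ' x y : ℝ → Vec n}
    (h : SolvesOn τ f a b ψ x) (hψ : ψ =ᵐ[histMeasure (maxDelay τ)] ψ') (h0 : ψ 0 = ψ' 0)
    (hxy : EqOn x y (Icc a b)) : SolvesOn τ f a b ψ' y := by
  refine ⟨h.cont.congr hxy.symm, fun t ht => ?_⟩
  rw [← hxy ht, h.eq_integral t ht, h0]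
  congr 1
  refine intervalIntegral.integral_congr_ae ?_
  filter_upwards [(ae_restrict_iff' measurableSet_Icc).1
    (vectorField_congr (f := f) hτ0 hτ (concat_congr_ae hψ hxy))] with s hs hs'
  rw [uIoc_of_le ht.1] at hs'
  exact hs ⟨hs'.1.le, hs'.2.trans ht.2⟩

/-- Gronwall with `δ = 0`: the initial values cancel, and the difference of the solutions is exactly
the integral of the difference of the vector fields. -/
theorem SolvesOn.eqOn (hτ0 : τ 0 = 0) (hτ : StrictMono τ) (hf : UniformlyRegular τ {f})
    {a b R : ℝ} {ψ x y : ℝ → Vec n} (ha : 0 ≤ a) (hψ : EssBddOn (-maxDelay τ) 0 R ψ)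
    (hx : SolvesOn τ f a b ψ x) (hy : SolvesOn τ f a b ψ y) : EqOn x y (Icc a b) := by
  intro t ht
  rcases ht.1.eq_or_lt with rfl | hat
  · rw [hx.apply_left ht.2, hy.apply_left ht.2]
  have hab : a < b := hat.trans_le ht.2
  obtain ⟨M, hM⟩ := isCompact_Icc.exists_bound_of_continuousOn hx.cont
  obtain ⟨N, hN⟩ := isCompact_Icc.exists_bound_of_continuousOn hy.cont
  obtain ⟨C, -, hC⟩ := exists_gronwall hτ0 hτ hf (R := max 1 (max R (max M N)))
    (lt_of_lt_of_le one_pos (le_max_left _ _)) (ha.trans_lt hab)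
  have h := hC ψ x y a b 0 ha le_rfl le_rfl (hψ.mono le_rfl le_rfl (by simp)) hx.cont hy.cont
    (fun t ht => (hM t ht).trans (by simp)) (fun t ht => (hN t ht).trans (by simp))
    (fun r hr => by
      have hsub := Icc_subset_Icc (le_refl a) hr.2
      rw [intervalIntegral.integral_sub
        (intervalIntegrable_vectorField hτ0 hτ hf ha hr.1 hψ (hx.cont.mono hsub))
        (intervalIntegrable_vectorField hτ0 hτ hf ha hr.1 hψ (hy.cont.mono hsub)),
        hx.eq_integral r hr, hy.eq_integral r hr, zero_add]
      simp) t ht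
  rw [mul_zero] at h
  exact sub_eq_zero.1 (norm_le_zero_iff.1 h)

theorem IsForwardInterval.Icc_subset {a b : ℝ} {J : Set ℝ} (h : IsForwardInterval a J)
    (hb : b ∈ J) : Icc a b ⊆ J := by
  rcases h with rfl | ⟨c, -, rfl | rfl⟩
  · exact Icc_subset_Ici_self
  · exact fun t ht => ⟨ht.1, ht.2.trans_lt hb.2⟩
  · exact fun t ht => ⟨ht.1, ht.2.trans hb.2⟩

theorem IsForwardInterval.subset_Ici {a : ℝ} {J : Set ℝ} (h : IsForwardInterval a J) :
    J ⊆ Ici a := by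
  rcases h with rfl | ⟨c, -, rfl | rfl⟩
  · exact le_rfl
  · exact Ico_subset_Ici_self
  · exact Icc_subset_Ici_self

theorem IsSolution.solvesOn {a b : ℝ} {J : Set ℝ} {ψ x : ℝ → Vec n}
    (h : IsSolution τ f a ψ J x) (hb : b ∈ J) : SolvesOn τ f a b ψ x := by
  have hab : a ≤ b := h.interval.subset_Ici hb
  refine ⟨?_, fun t ht => h.eq_integral t (h.interval.Icc_subset hb ht)⟩
  have := (h.absCont b hb).continuousOn
  rwa [uIcc_of_le hab] at this

/-- Solutions are Lipschitz with a constant that depends on bounds for the trajectory only. -/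
theorem exists_solution_lipschitz (hτ0 : τ 0 = 0) (hτ : StrictMono τ)
    (hf : UniformlyRegular τ {f}) {R T : ℝ} (hR : 0 < R) (hT : 0 < T) :
    ∃ C : NNReal, ∀ (ψ x : ℝ → Vec n) (a b : ℝ), 0 ≤ a → b ≤ T →
      EssBddOn (-maxDelay τ) 0 R ψ → SolvesOn τ f a b ψ x → (∀ t ∈ Icc a b, ‖x t‖ ≤ R) →
      LipschitzOnWith C x (Icc a b) := by
  obtain ⟨C, hC, hbd⟩ := exists_vectorField_bound hτ0 hτ hf hR hT
  refine ⟨C.toNNReal, fun ψ x a b ha hb hψ hx hxR => ?_⟩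
  refine LipschitzOnWith.of_dist_le_mul fun s hs t ht => ?_
  have hint : ∀ r ∈ Icc a b, IntervalIntegrable (vectorField τ f (concat a ψ x)) volume a r :=
    fun r hr => intervalIntegrable_vectorField hτ0 hτ hf ha hr.1 hψ
      (hx.cont.mono (Icc_subset_Icc le_rfl hr.2))
  rw [dist_eq_norm, hx.eq_integral s hs, hx.eq_integral t ht, add_sub_add_left_eq_sub,
    intervalIntegral.integral_interval_sub_left (hint s hs) (hint t ht), Real.coe_toNNReal C hC,
    Real.dist_eq]
  refine intervalIntegral.norm_integral_le_of_norm_le_const_ae ?_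
  filter_upwards [(ae_restrict_iff' measurableSet_Icc).1
    (hbd _ a b ha hb (hψ.concat hx.cont hxR))] with r hr hr'
  rw [uIoc_eq_union] at hr'
  rcases hr' with hr' | hr'
  · exact hr ⟨ht.1.trans hr'.1.le, hr'.2.trans hs.2⟩
  · exact hr ⟨hs.1.trans hr'.1.le, hr'.2.trans ht.2⟩

theorem MemCalLInf.exists_essBddOn {Δ : ℝ} {ψ : ℝ → Vec n} (h : MemCalLInf Δ ψ) :
    ∃ R, EssBddOn (-Δ) 0 R ψ :=
  ⟨_, essBddOn_of_ae_eq (MemLp.coeFn_toLp h).symm le_rfl⟩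

/-- Absolute continuity is not part of `SolvesOn`; it comes from the Lipschitz bound on compact
intervals. -/
theorem isSolution_Ici (hτ0 : τ 0 = 0) (hτ : StrictMono τ) (hf : UniformlyRegular τ {f})
    {a : ℝ} {ψ x : ℝ → Vec n} (ha : 0 ≤ a) (hψ : MemCalLInf (maxDelay τ) ψ)
    (hx : ∀ b, a ≤ b → SolvesOn τ f a b ψ x) : IsSolution τ f a ψ (Ici a) x := by
  obtain ⟨R, hR⟩ := hψ.exists_essBddOn
  refine ⟨Or.inl rfl, fun t (ht : a ≤ t) => ?_, fun t (ht : a ≤ t) =>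
    intervalIntegrable_vectorField hτ0 hτ hf ha ht hR (hx t ht).cont,
    fun t (ht : a ≤ t) => (hx t ht).eq_integral t ⟨ht, le_rfl⟩⟩
  obtain ⟨M, hM⟩ := isCompact_Icc.exists_bound_of_continuousOn (hx t ht).cont
  obtain ⟨C, hC⟩ := exists_solution_lipschitz hτ0 hτ hf (R := max 1 (max R M)) (T := t + 1)
    (lt_of_lt_of_le one_pos (le_max_left _ _)) (by linarith)
  have := hC ψ x a t ha (by linarith) (hR.mono le_rfl le_rfl (by simp)) (hx t ht)
    fun r hr => (hM r hr).trans (by simp)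
  rw [← uIcc_of_le ht] at this
  exact this.absolutelyContinuousOnInterval

theorem IsSolution.isMaximalSolution_Ici {a : ℝ} {ψ x : ℝ → Vec n}
    (h : IsSolution τ f a ψ (Ici a) x) : IsMaximalSolution τ f a ψ (Ici a) x :=
  ⟨h, fun _ _ hy hJ _ => hy.interval.subset_Ici.antisymm hJ⟩

/-- By uniqueness the global solution extends `y`, so maximality leaves no room for a smaller
interval. -/
theorem IsMaximalSolution.eq_Ici (hτ0 : τ 0 = 0) (hτ : StrictMono τ)
    (hf : UniformlyRegular τ {f}) {a : ℝ} {ψ x y : ℝ → Vec n} {J : Set ℝ} (ha : 0 ≤ a)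
    (hψ : MemCalLInf (maxDelay τ) ψ) (hy : IsMaximalSolution τ f a ψ J y)
    (hx : ∀ b, a ≤ b → SolvesOn τ f a b ψ x) : J = Ici a := by
  obtain ⟨R, hR⟩ := hψ.exists_essBddOn
  refine (hy.2 (Ici a) x (isSolution_Ici hτ0 hτ hf ha hψ hx) hy.1.interval.subset_Ici
    fun t ht => ?_).symm
  have hat : a ≤ t := hy.1.interval.subset_Ici ht
  exact SolvesOn.eqOn hτ0 hτ hf ha hR (hx t hat) (hy.1.solvesOn ht) ⟨hat, le_rfl⟩

theorem forwardCompleteOn_univ (hτ0 : τ 0 = 0) (hτ : StrictMono τ) (hf : UniformlyRegular τ {f})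
    (h : ∀ (a : ℝ) (ψ : ℝ → Vec n), 0 ≤ a → MemCalLInf (maxDelay τ) ψ →
      ∃ x, ∀ b, a ≤ b → SolvesOn τ f a b ψ x) : ForwardCompleteOn τ f univ := by
  intro a ha p _
  constructor
  -- Prescribing the value at `0` changes a representative only on a null set.
  · set ψ : ℝ → Vec n := fun s => if s = 0 then p.1 else p.2 s with hψ
    have hae : ψ =ᵐ[histMeasure (maxDelay τ)] p.2 := by
      have hne : ∀ᵐ r ∂histMeasure (maxDelay τ), r ≠ 0 :=
        ae_restrict_of_ae (by simp [ae_iff, measure_singleton])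
      filter_upwards [hne] with r hr
      rw [hψ]; exact if_neg hr
    have hmem : MemCalLInf (maxDelay τ) ψ := (memLp_congr_ae hae).2 (Lp.memLp p.2)
    obtain ⟨x, hx⟩ := h a ψ ha hmem
    exact ⟨Ici a, x, ψ, hmem, hae, if_pos rfl,
      (isSolution_Ici hτ0 hτ hf ha hmem hx).isMaximalSolution_Ici⟩
  · rintro J y ⟨ψ, hmem, -, -, hy⟩
    obtain ⟨x, hx⟩ := h a ψ ha hmem
    exact hy.eq_Ici hτ0 hτ hf ha hmem hx

/-- A continuation of a solution on `[a,c]` by a solution from time `c` on. -/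
theorem SolvesOn.glue (hτ0 : τ 0 = 0) (hτ : StrictMono τ) (hf : UniformlyRegular τ {f})
    {a c b R : ℝ} {ψ x y χ : ℝ → Vec n} (ha : 0 ≤ a) (hac : a ≤ c) (hcb : c ≤ b)
    (hψ : EssBddOn (-maxDelay τ) 0 R ψ) (hx : SolvesOn τ f a c ψ x) (hy : SolvesOn τ f c b χ y)
    (hχ : χ =ᵐ[histMeasure (maxDelay τ)] fun s => concat a ψ x (c + s)) (h0 : χ 0 = x c) :
    SolvesOn τ f a b ψ (fun t => if t < c then x t else y t) := by
  set z : ℝ → Vec n := fun t => if t < c then x t else y t with hz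
  have hyc : y c = x c := by rw [hy.apply_left hcb, h0]
  have hzx : EqOn x z (Icc a c) := fun t ht => by
    rcases ht.2.lt_or_eq with h | rfl
    · simp [hz, h]
    · simp [hz, hyc]
  have hzy : EqOn y z (Icc c b) := fun t ht => by simp [hz, ht.1.not_gt]
  have h1 : SolvesOn τ f a c ψ z := hx.congr hτ0 hτ (ae_eq_refl _) rfl hzx
  have h2 : SolvesOn τ f c b (fun s => concat a ψ z (c + s)) z := by
    refine hy.congr hτ0 hτ ?_ ?_ hzy
    · filter_upwards [hχ, ae_restrict_mem measurableSet_Icc] with s hs hs'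
      rw [hs]
      rcases lt_or_ge (c + s) a with h | h
      · simp only [concat_of_lt h]
      · simp only [concat_of_ge h]
        exact hzx ⟨h, by linarith [hs'.2]⟩
    · simp only [add_zero, concat_of_ge hac, h0]
      exact hzx ⟨hac, le_rfl⟩
  have hzc : ContinuousOn z (Icc a b) := by
    rw [← Icc_union_Icc_eq_Icc hac hcb]
    exact h1.cont.union_of_isClosed h2.cont isClosed_Icc isClosed_Icc
  refine ⟨hzc, fun t ht => ?_⟩
  rcases le_total t c with htc | htc
  · exact h1.eq_integral t ⟨ht.1, htc⟩
  · have e := h2.eq_integral t ⟨htc, ht.2⟩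
    rw [concat_shift hac] at e
    have hc := h1.eq_integral c ⟨hac, le_rfl⟩
    have i1 := intervalIntegrable_vectorField (f := f) hτ0 hτ hf ha hac hψ h1.cont
    have i2 := intervalIntegrable_vectorField (f := f) hτ0 hτ hf ha ht.1 hψ
      (hzc.mono (Icc_subset_Icc le_rfl ht.2))
    rw [e]
    simp only [add_zero, concat_of_ge hac]
    rw [hc, add_assoc, intervalIntegral.integral_add_adjacent_intervals i1
      (i1.symm.trans i2)]

/-! ### Weak-* convergence -/

theorem integrable_dotProduct {μ : Measure ℝ} {g u : ℝ → Vec n} {R : ℝ} (hg : Integrable g μ)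
    (hu : AEStronglyMeasurable u μ) (hR : ∀ᵐ s ∂μ, ‖u s‖ ≤ R) :
    Integrable (fun s => g s ⬝ᵥ u s) μ := by
  simp only [dotProduct]
  refine integrable_finsetSum _ fun i _ => ?_
  refine (hg.eval i).mul_bdd (c := R) ((continuous_apply i).comp_aestronglyMeasurable hu) ?_
  filter_upwards [hR] with s hs
  exact (norm_le_pi_norm (u s) i).trans hs

theorem norm_dotProduct_le (v w : Vec n) : ‖v ⬝ᵥ w‖ ≤ n * (‖v‖ * ‖w‖) := by
  rw [dotProduct]
  refine (norm_sum_le _ _).trans ?_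
  calc ∑ i, ‖v i * w i‖ ≤ ∑ _i : Fin n, ‖v‖ * ‖w‖ := Finset.sum_le_sum fun i _ => by
        rw [norm_mul]
        exact mul_le_mul (norm_le_pi_norm v i) (norm_le_pi_norm w i) (norm_nonneg _) (norm_nonneg _)
    _ = n * (‖v‖ * ‖w‖) := by simp

theorem weakStarTendsto_of_ae_tendsto {Δ R : ℝ} {φ : ℕ → LInf n Δ} {φ₀ : LInf n Δ}
    (hR : ∀ k, ‖φ k‖ ≤ R)
    (h : ∀ᵐ s ∂histMeasure Δ, Tendsto (fun k => φ k s) atTop (𝓝 (φ₀ s))) :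
    WeakStarTendsto φ φ₀ := by
  intro g hg
  refine tendsto_integral_of_dominated_convergence (fun s => n * (‖g s‖ * R)) (fun k => ?_)
    ((hg.norm.mul_const R).const_mul _) (fun k => ?_) ?_
  · exact (integrable_dotProduct hg (Lp.aestronglyMeasurable _)
      ((ae_norm_le_norm (φ k)))).aestronglyMeasurable
  · filter_upwards [ae_norm_le_norm (φ k)] with s hs
    refine (norm_dotProduct_le _ _).trans ?_
    have := hs.trans (hR k)
    gcongr
  · filter_upwards [h] with s hs
    exact ((continuous_const.dotProduct continuous_id).tendsto (φ₀ s)).comp hs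

/-- The segment sees the history for `s < a - t` and the continuation afterwards. Translation moves
the shift in the first part onto the test function, and the second part does not involve the
history. -/
theorem integral_dotProduct_segment {a Δ t R : ℝ} (ht : t ∈ Icc a (a + Δ)) {g ψ x : ℝ → Vec n}
    (hg : Integrable g (histMeasure Δ)) (hψ : EssBddOn (-Δ) 0 R ψ)
    (hx : ContinuousOn x (Icc a t)) (hxR : ∀ s ∈ Icc a t, ‖x s‖ ≤ R) :
    ∫ s in Icc (-Δ) 0, g s ⬝ᵥ segment Δ (concat a ψ x) t s =
      (∫ s in Icc (-Δ) 0, (Ico (-Δ) (a - t)).indicator g (s - (t - a)) ⬝ᵥ ψ s) +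
      ∫ s in Icc (-Δ) 0, (Ico (-Δ) (a - t))ᶜ.indicator g s ⬝ᵥ x (t + s) := by
  set A := Ico (-Δ) (a - t) with hA
  have hX : EssBddOn (t - Δ) t R (concat a ψ x) :=
    (hψ.concat hx hxR).mono (by linarith [ht.1]) le_rfl le_rfl
  have hseg := hX.memLp_segment
  have e1 : ∫ s in Icc (-Δ) 0, A.indicator g (s - (t - a)) ⬝ᵥ ψ s =
      ∫ s in Icc (-Δ) 0, A.indicator g s ⬝ᵥ concat a ψ x (t + s) := by
    -- Both integrands vanish off `[-Δ, 0]`, so the integrals extend to `ℝ`, where translation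
    -- invariance is available.
    rw [setIntegral_eq_integral_of_forall_compl_eq_zero, setIntegral_eq_integral_of_forall_compl_eq_zero,
      ← integral_add_right_eq_self _ (t - a)]
    · congr 1
      funext s
      rw [add_sub_cancel_right]
      by_cases hs : s ∈ A
      · rw [concat_of_lt (by linarith [hs.2])]
        congr 2; ring
      · simp [hs]
    · intro s hs
      have : s ∉ A := fun h => hs ⟨h.1, by linarith [h.2, ht.1]⟩
      simp [this]
    · intro s hs
      have : s - (t - a) ∉ A := fun h => hs ⟨by linarith [h.1, ht.1], by linarith [h.2]⟩
      simp [this]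
  have e2 : ∫ s in Icc (-Δ) 0, Aᶜ.indicator g s ⬝ᵥ x (t + s) =
      ∫ s in Icc (-Δ) 0, Aᶜ.indicator g s ⬝ᵥ concat a ψ x (t + s) := by
    refine setIntegral_congr_fun measurableSet_Icc fun s hs => ?_
    by_cases h : s ∈ A
    · simp [h]
    · have : a ≤ t + s := by
        by_contra hlt
        exact h ⟨hs.1, by linarith⟩
      simp only [concat_of_ge this]
  have hb := ae_histMeasure_of_ae_restrict hX.bound
  rw [e1, e2, ← integral_add
    (integrable_dotProduct (hg.indicator measurableSet_Ico) hseg.aestronglyMeasurable hb)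
    (integrable_dotProduct (hg.indicator measurableSet_Ico.compl) hseg.aestronglyMeasurable hb)]
  refine integral_congr_ae ?_
  filter_upwards [hX.coeFn_segment] with s hs
  rw [hs, ← add_dotProduct]
  congr 1
  simp

theorem WeakStarTendsto.segment {a Δ t R : ℝ} (ht : t ∈ Icc a (a + Δ)) {φ : ℕ → LInf n Δ}
    {φ₀ : LInf n Δ} {x : ℝ → Vec n} (h : WeakStarTendsto φ φ₀) (hφ : ∀ k, ‖φ k‖ ≤ R)
    (hφ₀ : ‖φ₀‖ ≤ R) (hx : ContinuousOn x (Icc a t)) (hxR : ∀ s ∈ Icc a t, ‖x s‖ ≤ R) :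
    WeakStarTendsto (fun k => segment Δ (concat a (φ k) x) t) (segment Δ (concat a φ₀ x) t) := by
  intro g hg
  simp only [integral_dotProduct_segment ht hg (essBddOn_coeFn _ (hφ _)) hx hxR,
    integral_dotProduct_segment ht hg (essBddOn_coeFn _ hφ₀) hx hxR]
  refine (h (fun s => (Ico (-Δ) (a - t)).indicator g (s - (t - a))) ?_).add_const _
  have hi : Integrable ((Ico (-Δ) (a - t)).indicator g) volume :=
    (IntegrableOn.mono_set hg
      (Ico_subset_Icc_self.trans (Icc_subset_Icc le_rfl (by linarith [ht.1])))).integrable_indicator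
      measurableSet_Ico
  exact (hi.comp_sub_right (t - a)).restrict

/-- The integrated vector field along a fixed continuation depends weak-* continuously on the
history. -/
theorem WeakStarRegular.tendsto_integral (hℓ : 1 ≤ ℓ) (hτ0 : τ 0 = 0) (hτ : StrictMono τ)
    (hf : WeakStarRegular τ {f}) {a R ε : ℝ} {x ψ₀ : ℝ → Vec n} {ψ : ℕ → ℝ → Vec n}
    {φ : ℕ → LInf n (maxDelay τ)} {φ₀ : LInf n (maxDelay τ)} (ha : 0 ≤ a) (hR : 0 < R) (hε : 0 < ε)
    (hψ : ∀ k, ψ k =ᵐ[histMeasure (maxDelay τ)] φ k) (hψ₀ : ψ₀ =ᵐ[histMeasure (maxDelay τ)] φ₀)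
    (hx : ContinuousOn x (Icc a (a + maxDelay τ))) (hxR : ∀ t ∈ Icc a (a + maxDelay τ), ‖x t‖ ≤ R)
    (hφ : ∀ k, ‖φ k‖ ≤ R) (hφ₀ : ‖φ₀‖ ≤ R) (h : WeakStarTendsto φ φ₀) :
    ∃ j : ℕ, ∀ k ≥ j, ∀ t ∈ Icc a (a + maxDelay τ),
      ‖∫ s in a..t, (vectorField τ f (concat a (ψ k) x) s - vectorField τ f (concat a ψ₀ x) s)‖
        < ε := by
  have hΔ := maxDelay_pos hℓ hτ0 hτ
  set b := a + maxDelay τ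
  have hab : a ≤ b := by linarith
  set X : ℕ → ℝ → Vec n := fun k => concat a (φ k) x
  set X₀ : ℝ → Vec n := concat a φ₀ x
  have hX : ∀ k, EssBddOn (a - maxDelay τ) b R (X k) := fun k => (essBddOn_coeFn _ (hφ k)).concat hx hxR
  have hX₀ : EssBddOn (a - maxDelay τ) b R X₀ := (essBddOn_coeFn _ hφ₀).concat hx hxR
  -- In `d` only the discrete arguments change, with the limit segment frozen; in `g` only the
  -- segment changes, with the discrete arguments of `X k` frozen.
  set d : ℕ → ℝ → Vec n := fun k s =>
    f s (delayed τ (X k) s) (segment (maxDelay τ) X₀ s) - f s (delayed τ X₀ s) (segment (maxDelay τ) X₀ s) with hd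
  set g : ℕ → ℝ → Vec n := fun k s =>
    f s (delayed τ (X k) s) (segment (maxDelay τ) (X k) s) - f s (delayed τ (X k) s) (segment (maxDelay τ) X₀ s) with hg
  obtain ⟨j₁, hj₁⟩ := hf.discrete_cont a R (ε / 2) x φ φ₀ ha hR.le (half_pos hε) hx hxR hφ h
  replace hj₁ : ∀ t ∈ Icc a b, ∀ k ≥ j₁, IntervalIntegrable (d k) volume a t ∧
    ‖∫ s in a..t, d k s‖ < ε / 2 := hj₁ f rfl
  obtain ⟨Z, hZ, hweak⟩ := hf.weakStar_cont b R (by linarith) hR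
  replace hZ := hZ f rfl
  obtain ⟨L, hL, hlip⟩ := hf.regular.lipschitz R b hR (by linarith)
  obtain ⟨Z', hZ', hlip⟩ := hlip f rfl
  have hii : ∀ k, IntervalIntegrable (vectorField τ f (X k)) volume a b := fun k =>
    intervalIntegrable_vectorField hτ0 hτ hf.regular ha hab (essBddOn_coeFn _ (hφ k)) hx
  have hii₀ : IntervalIntegrable (vectorField τ f X₀) volume a b :=
    intervalIntegrable_vectorField hτ0 hτ hf.regular ha hab (essBddOn_coeFn _ hφ₀) hx
  have hsplit : ∀ k s, g k s = vectorField τ f (X k) s - vectorField τ f X₀ s - d k s := by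
    intro k s
    simp only [hg, hd, vectorField, sub_sub_sub_cancel_right]
  -- The mixed term is not a vector field along a trajectory. Its integrability comes from that of
  -- two genuine vector fields and of `d k`, the latter from `discrete_cont`.
  have hgi : ∀ k ≥ j₁, IntervalIntegrable (g k) volume a b := fun k hk => by
    have := ((hii k).sub hii₀).sub (hj₁ b ⟨hab, le_rfl⟩ k hk).1
    exact this.congr (fun s _ => (hsplit k s).symm)
  have hdel : ∀ᵐ s ∂volume.restrict (Icc a b), ∀ k, ∀ i, ‖X k (s - τ i)‖ ≤ R :=
    ae_all_iff.2 fun k => ae_delayed hτ0 hτ (hX k).bound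
  have hnZ : ∀ᵐ s ∂volume.restrict (Icc a b), s ∉ Z f ∧ s ∉ Z' :=
    ae_restrict_of_ae ((measure_eq_zero_iff_ae_notMem.1 hZ).and
      (measure_eq_zero_iff_ae_notMem.1 hZ'))
  have hsegk : ∀ s ∈ Icc a b, ∀ k, ‖segment (maxDelay τ) (X k) s‖ ≤ R := fun s hs k =>
    ((hX k).mono (by linarith [hs.1]) hs.2 le_rfl).norm_segment_le hR.le
  have hseg₀ : ∀ s ∈ Icc a b, ‖segment (maxDelay τ) X₀ s‖ ≤ R := fun s hs =>
    (hX₀.mono (by linarith [hs.1]) hs.2 le_rfl).norm_segment_le hR.le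
  -- Integrating the norm over the whole window bounds the integrals up to every `t` at once.
  have hlim : Tendsto (fun k => ∫ s in a..b, ‖g k s‖) atTop (𝓝 (∫ _s in a..b, (0 : ℝ))) := by
    refine intervalIntegral.tendsto_integral_filter_of_dominated_convergence
      (fun _ => L * (2 * R)) ?_ ?_ (by simp) ?_
    · filter_upwards [eventually_ge_atTop j₁] with k hk
      exact (hgi k hk).aestronglyMeasurable_restrict_uIoc.norm
    · refine Eventually.of_forall fun k => ?_
      filter_upwards [(ae_restrict_iff' measurableSet_Icc).1 hdel,
        (ae_restrict_iff' measurableSet_Icc).1 hnZ] with s h1 h2 hs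
      rw [uIoc_of_le hab] at hs
      have hs' := Ioc_subset_Icc_self hs
      have hdk := norm_delayed_le hR.le (h1 hs' k)
      rw [norm_norm]
      refine (hlip _ _ _ _ hdk hdk (hsegk s hs' k) (hseg₀ s hs') s
        ⟨⟨ha.trans hs'.1, hs'.2⟩, (h2 hs').2⟩).trans (mul_le_mul_of_nonneg_left ?_ hL)
      refine max_le (by simp; linarith) ((norm_sub_le _ _).trans ?_)
      linarith [hsegk s hs' k, hseg₀ s hs']
    · filter_upwards [(ae_restrict_iff' measurableSet_Icc).1 hdel,
        (ae_restrict_iff' measurableSet_Icc).1 hnZ] with s h1 h2 hs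
      rw [uIoc_of_le hab] at hs
      have hs' := Ioc_subset_Icc_self hs
      have hsub := Icc_subset_Icc (le_refl a) hs'.2
      have hws : WeakStarTendsto (fun k => segment (maxDelay τ) (X k) s) (segment (maxDelay τ) X₀ s) :=
        h.segment hs' hφ hφ₀ (hx.mono hsub) fun r hr => hxR r (hsub hr)
      rw [Metric.tendsto_atTop]
      intro η hη
      -- Uniformity in `ξ` is essential here: the discrete arguments vary with `k` and need not
      -- converge.
      obtain ⟨j, hj⟩ := hweak η _ _ hη (hsegk s hs') hws
      refine ⟨j, fun k hk => ?_⟩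
      rw [dist_zero_right, norm_norm]
      exact hj f rfl s ⟨⟨ha.trans hs'.1, hs'.2⟩, (h2 hs').1⟩ _
        (norm_delayed_le hR.le (h1 hs' k)) k hk
  rw [intervalIntegral.integral_zero] at hlim
  obtain ⟨j₂, hj₂⟩ := Metric.tendsto_atTop.1 hlim (ε / 2) (half_pos hε)
  refine ⟨max j₁ j₂, fun k hk t ht => ?_⟩
  have hk₁ := (le_max_left j₁ j₂).trans hk
  have hsub : uIcc a t ⊆ uIcc a b := by
    rw [uIcc_of_le ht.1, uIcc_of_le hab]; exact Icc_subset_Icc le_rfl ht.2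
  have hEq : ∫ s in a..t, (vectorField τ f (concat a (ψ k) x) s - vectorField τ f (concat a ψ₀ x) s)
      = (∫ s in a..t, g k s) + ∫ s in a..t, d k s := by
    rw [← intervalIntegral.integral_add ((hgi k hk₁).mono_set hsub) (hj₁ t ht k hk₁).1]
    refine intervalIntegral.integral_congr_ae ?_
    filter_upwards [(ae_restrict_iff' measurableSet_Icc).1
        (vectorField_congr (f := f) hτ0 hτ (concat_congr_ae (a := a) (b := b) (x := x) (hψ k)
          fun _ _ => rfl)),
      (ae_restrict_iff' measurableSet_Icc).1
        (vectorField_congr (f := f) hτ0 hτ (concat_congr_ae (a := a) (b := b) (x := x) hψ₀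
          fun _ _ => rfl))] with s h1 h2 hs
    rw [uIoc_of_le ht.1] at hs
    have hs' : s ∈ Icc a b := ⟨hs.1.le, hs.2.trans ht.2⟩
    rw [h1 hs', h2 hs', hsplit, sub_add_cancel]
  have hg2 : ‖∫ s in a..t, g k s‖ < ε / 2 := by
    have h1 : ‖∫ s in a..t, g k s‖ ≤ ∫ s in a..t, ‖g k s‖ :=
      intervalIntegral.norm_integral_le_integral_norm ht.1
    have h2 : ∫ s in a..t, ‖g k s‖ ≤ ∫ s in a..b, ‖g k s‖ :=
      intervalIntegral.integral_mono_interval le_rfl ht.1 ht.2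
        (Eventually.of_forall fun _ => norm_nonneg _) (hgi k hk₁).norm
    have h3 := hj₂ k ((le_max_right _ _).trans hk)
    rw [dist_zero_right, Real.norm_eq_abs] at h3
    exact (h1.trans h2).trans_lt ((le_abs_self _).trans_lt h3)
  rw [hEq]
  calc _ ≤ ‖∫ s in a..t, g k s‖ + ‖∫ s in a..t, d k s‖ := norm_add_le _ _
    _ < ε / 2 + ε / 2 := add_lt_add hg2 (hj₁ t ht k hk₁).2
    _ = ε := add_halves ε

/-! ### Arzelà–Ascoli and sequential weak-* compactness -/

/-- Arzelà–Ascoli for sequences of uniformly bounded, equi-Lipschitz functions on `[a,b]`. -/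
theorem exists_subseq_tendstoUniformlyOn {a b M : ℝ} {C : NNReal} (hab : a ≤ b)
    {u : ℕ → ℝ → Vec n} (hu : ∀ k, LipschitzOnWith C (u k) (Icc a b))
    (hM : ∀ k, ∀ t ∈ Icc a b, ‖u k t‖ ≤ M) :
    ∃ σ : ℕ → ℕ, StrictMono σ ∧ ∃ v : ℝ → Vec n,
      TendstoUniformlyOn (fun k => u (σ k)) v atTop (Icc a b) := by
  set F : ℕ → BoundedContinuousFunction (Icc a b) (Vec n) := fun k =>
    BoundedContinuousFunction.mkOfCompact ⟨(Icc a b).domRestrict (u k), (hu k).continuousOn.domRestrict⟩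
    with hF
  have hFu : ∀ k t, F k t = u k t := fun k t => rfl
  have hcomp : IsCompact (closure (range F)) := by
    refine BoundedContinuousFunction.arzela_ascoli (Metric.closedBall 0 M)
      (isCompact_closedBall 0 M) (range F) ?_ ?_
    · rintro _ t ⟨k, rfl⟩
      rw [mem_closedBall_zero_iff, hFu]
      exact hM k t t.2
    · refine (LipschitzWith.uniformEquicontinuous _ C ?_).equicontinuous
      rintro ⟨_, k, rfl⟩
      exact (hu k).to_restrict
  obtain ⟨G, -, σ, hσ, hG⟩ := hcomp.tendsto_subseq fun k => subset_closure (mem_range_self k)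
  refine ⟨σ, hσ, fun t => G (projIcc a b hab t), ?_⟩
  have hG' := BoundedContinuousFunction.tendsto_iff_tendstoUniformly.1 hG
  rw [Metric.tendstoUniformlyOn_iff]
  intro ε hε
  filter_upwards [Metric.tendstoUniformly_iff.1 hG' ε hε] with k hk t ht
  have := hk ⟨t, ht⟩
  rwa [projIcc_of_mem hab ht]

theorem LipschitzOnWith.of_tendstoUniformlyOn {a b : ℝ} {C : NNReal} {u : ℕ → ℝ → Vec n}
    {v : ℝ → Vec n} (hu : ∀ k, LipschitzOnWith C (u k) (Icc a b))
    (h : TendstoUniformlyOn u v atTop (Icc a b)) : LipschitzOnWith C v (Icc a b) :=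
  LipschitzOnWith.of_dist_le_mul fun s hs t ht =>
    le_of_tendsto ((h.tendsto_at hs).dist (h.tendsto_at ht))
      (Eventually.of_forall fun k => (hu k).dist_le_mul s hs t ht)

/-- A π-λ argument from half-lines. For disjoint unions the uniform bound dominates the series by
`R` times the measures of the pieces, so limit and sum may be exchanged. -/
theorem tendsto_setIntegral_of_Iic {Δ R : ℝ} {w : ℕ → ℝ → ℝ}
    (hw : ∀ k, AEStronglyMeasurable (w k) (histMeasure Δ))
    (hR : ∀ k, ∀ᵐ s ∂histMeasure Δ, ‖w k s‖ ≤ R)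
    (h : ∀ t, Tendsto (fun k => ∫ s in Iic t, w k s ∂histMeasure Δ) atTop (𝓝 0))
    {A : Set ℝ} (hA : MeasurableSet A) :
    Tendsto (fun k => ∫ s in A, w k s ∂histMeasure Δ) atTop (𝓝 0) := by
  have hint : ∀ k, Integrable (w k) (histMeasure Δ) := fun k =>
    Integrable.of_bound (hw k) R (hR k)
  have huniv : Tendsto (fun k => ∫ s, w k s ∂histMeasure Δ) atTop (𝓝 0) := by
    have e : ∀ k, ∫ s, w k s ∂histMeasure Δ = ∫ s in Iic 0, w k s ∂histMeasure Δ := fun k => by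
      rw [histMeasure, Measure.restrict_restrict measurableSet_Iic]
      congr 2
      ext s; simp
    simp only [e]; exact h 0
  induction A, hA using MeasurableSpace.induction_on_inter
    ((BorelSpace.measurable_eq (α := ℝ)).trans (borel_eq_generateFrom_Iic ℝ)) isPiSystem_Iic with
  | empty => simp
  | basic t ht => obtain ⟨r, rfl⟩ := ht; exact h r
  | compl t ht ih =>
    have e : ∀ k, ∫ s in tᶜ, w k s ∂histMeasure Δ =
        ∫ s, w k s ∂histMeasure Δ - ∫ s in t, w k s ∂histMeasure Δ := fun k => by
      rw [← integral_add_compl ht (hint k), add_sub_cancel_left]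
    simp only [e]
    simpa using huniv.sub ih
  | iUnion g hd hg ih =>
    have e : ∀ k, ∫ s in ⋃ i, g i, w k s ∂histMeasure Δ =
        ∑' i, ∫ s in g i, w k s ∂histMeasure Δ := fun k =>
      ((hasSum_integral_iUnion hg hd (hint k).integrableOn).tsum_eq).symm
    simp only [e]
    rw [← tsum_zero (α := ℝ) (β := ℕ)]
    refine tendsto_tsum_of_dominated_convergence
      (bound := fun i => R * (histMeasure Δ).real (g i)) ?_ ih ?_
    · refine Summable.mul_left R ?_
      exact (hasSum_integral_iUnion (f := fun _ => (1 : ℝ)) (μ := histMeasure Δ) hg hd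
        (integrable_const 1).integrableOn).summable.congr fun i => by simp
    · refine Eventually.of_forall fun k i => ?_
      exact norm_setIntegral_le_of_norm_le_const_ae (measure_lt_top _ _)
        (ae_restrict_of_ae (hR k))

/-- Simple functions reduce to sets, and the uniform bound on `w` carries the convergence to `L^1`
limits. -/
theorem tendsto_integral_mul_of_Iic {Δ R : ℝ} {w : ℕ → ℝ → ℝ}
    (hw : ∀ k, AEStronglyMeasurable (w k) (histMeasure Δ))
    (hR : ∀ k, ∀ᵐ s ∂histMeasure Δ, ‖w k s‖ ≤ R)
    (h : ∀ t, Tendsto (fun k => ∫ s in Iic t, w k s ∂histMeasure Δ) atTop (𝓝 0))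
    {g : ℝ → ℝ} (hg : Integrable g (histMeasure Δ)) :
    Tendsto (fun k => ∫ s, g s * w k s ∂histMeasure Δ) atTop (𝓝 0) := by
  have hi : ∀ (g : ℝ → ℝ), Integrable g (histMeasure Δ) → ∀ k,
      Integrable (fun s => g s * w k s) (histMeasure Δ) := fun g hg k => hg.mul_bdd (hw k) (hR k)
  refine Integrable.induction (fun g : ℝ → ℝ =>
    Tendsto (fun k => ∫ s, g s * w k s ∂histMeasure Δ) atTop (𝓝 0)) ?_ ?_ ?_ ?_ hg
  · intro c A hs _
    have e : ∀ k, ∫ s, A.indicator (fun _ => c) s * w k s ∂histMeasure Δ =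
        c * ∫ s in A, w k s ∂histMeasure Δ := fun k => by
      rw [← integral_const_mul, ← integral_indicator hs]
      congr 1; funext s
      by_cases h : s ∈ A
      · simp [h]
      · simp [h]
    simp only [e]
    simpa using (tendsto_setIntegral_of_Iic hw hR h hs).const_mul c
  · intro f g _ hf hg ihf ihg
    have e : ∀ k, ∫ s, (f + g) s * w k s ∂histMeasure Δ =
        ∫ s, f s * w k s ∂histMeasure Δ + ∫ s, g s * w k s ∂histMeasure Δ := fun k => by
      rw [← integral_add (hi f hf k) (hi g hg k)]
      simp only [Pi.add_apply, add_mul]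
    simp only [e]
    simpa using ihf.add ihg
  · refine isClosed_of_closure_subset fun f hf => ?_
    rw [Set.mem_ofPred_eq, Metric.tendsto_atTop]
    intro ε hε
    obtain ⟨g, hg, hfg⟩ := Metric.mem_closure_iff.1 hf (ε / (2 * (|R| + 1))) (by positivity)
    obtain ⟨j, hj⟩ := Metric.tendsto_atTop.1 hg (ε / 2) (half_pos hε)
    refine ⟨j, fun k hk => ?_⟩
    have h1 := hj k hk
    rw [dist_zero_right] at h1 ⊢
    have e : ∫ s, f s * w k s ∂histMeasure Δ =
        ∫ s, (f s - g s) * w k s ∂histMeasure Δ + ∫ s, g s * w k s ∂histMeasure Δ := by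
      rw [← integral_add (hi (fun s => f s - g s)
        ((L1.integrable_coeFn f).sub (L1.integrable_coeFn g)) k) (hi _ (L1.integrable_coeFn g) k)]
      simp only [← add_mul, sub_add_cancel]
    have h2 : ‖∫ s, (f s - g s) * w k s ∂histMeasure Δ‖ ≤ (|R| + 1) * dist f g := by
      rw [dist_eq_norm, L1.norm_eq_integral_norm, ← integral_const_mul]
      refine norm_integral_le_of_norm_le ((L1.integrable_coeFn _).norm.const_mul _) ?_
      filter_upwards [hR k, Lp.coeFn_sub f g] with s hs hfg
      rw [hfg, norm_mul, Pi.sub_apply, mul_comm]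
      exact mul_le_mul_of_nonneg_right (hs.trans ((le_abs_self R).trans (by linarith)))
        (norm_nonneg _)
    have h3 : (|R| + 1) * dist f g < ε / 2 := by
      rw [lt_div_iff₀ (by positivity)] at hfg
      linarith
    rw [e]
    calc _ ≤ _ := norm_add_le _ _
      _ < ε / 2 + ε / 2 := add_lt_add (h2.trans_lt h3) h1
      _ = ε := add_halves ε
  · intro f g hfg _ ih
    refine ih.congr fun k => integral_congr_ae ?_
    filter_upwards [hfg] with s hs
    rw [hs]

/-- Bounded sequences in `L^∞` converge weak-* if their primitives converge pointwise. -/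
theorem weakStarTendsto_of_primitives {Δ R : ℝ} {φ : ℕ → LInf n Δ} {φ₀ : LInf n Δ}
    (hR : ∀ k, ‖φ k‖ ≤ R)
    (h : ∀ t ∈ Icc (-Δ) 0, Tendsto (fun k => ∫ s in (-Δ)..t, φ k s) atTop
      (𝓝 (∫ s in (-Δ)..t, φ₀ s))) : WeakStarTendsto φ φ₀ := by
  have hev : ∀ (φ : LInf n Δ), Integrable φ (histMeasure Δ) := fun φ =>
    Integrable.of_bound (Lp.aestronglyMeasurable φ) _ (ae_norm_le_norm φ)
  have hcomp : ∀ i, ∀ g : ℝ → ℝ, Integrable g (histMeasure Δ) →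
      Tendsto (fun k => ∫ s, g s * (φ k s i - φ₀ s i) ∂histMeasure Δ) atTop (𝓝 0) := by
    intro i g hg
    refine tendsto_integral_mul_of_Iic (R := R + ‖φ₀‖)
      (fun k => (((hev (φ k)).eval i).sub ((hev φ₀).eval i)).aestronglyMeasurable) (fun k => ?_)
      (fun t => ?_) hg
    · filter_upwards [ae_norm_le_norm (φ k), ae_norm_le_norm φ₀] with s h1 h2
      exact (norm_sub_le _ _).trans (add_le_add
        ((norm_le_pi_norm _ i).trans (h1.trans (hR k))) ((norm_le_pi_norm _ i).trans h2))
    · have e : ∀ φ : LInf n Δ, ∀ t, -Δ ≤ t → t ≤ 0 → ∫ s in Icc (-Δ) t, φ s i =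
          (∫ s in (-Δ)..t, φ s) i := fun φ t h1 h2 => by
        rw [integral_Icc_eq_integral_Ioc, intervalIntegral.integral_of_le h1]
        refine (eval_integral (fun j => ?_) i).symm
        exact ((hev φ).eval j).mono_measure (Measure.restrict_mono
          (Ioc_subset_Icc_self.trans (Icc_subset_Icc le_rfl h2)) le_rfl)
      have hset : (Iic t ∩ Icc (-Δ) 0) = Icc (-Δ) (min t 0) := by
        ext s; simp; tauto
      have hres : (histMeasure Δ).restrict (Iic t) = volume.restrict (Icc (-Δ) (min t 0)) := by
        rw [histMeasure, Measure.restrict_restrict measurableSet_Iic, hset]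
      rw [hres]
      rcases le_or_gt (-Δ) (min t 0) with hc | hc
      · have hsub : ∀ φ : LInf n Δ,
            Integrable (fun s => φ s i) (volume.restrict (Icc (-Δ) (min t 0))) := fun φ =>
          ((hev φ).eval i).mono_measure (Measure.restrict_mono
            (Icc_subset_Icc le_rfl (min_le_right _ _)) le_rfl)
        have h1 := ((continuous_apply i).tendsto _).comp (h (min t 0) ⟨hc, min_le_right _ _⟩)
        have h2 := h1.sub_const ((∫ s in (-Δ)..(min t 0), φ₀ s) i)
        rw [sub_self] at h2
        refine h2.congr fun k => ?_
        simp only [Pi.sub_apply]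
        rw [integral_sub (hsub _) (hsub _), e _ _ hc (min_le_right _ _),
          e _ _ hc (min_le_right _ _)]
        rfl
      · simp [Icc_eq_empty hc.not_ge]
  intro g hg
  have key : Tendsto (fun k => ∑ i, ∫ s, g s i * (φ k s i - φ₀ s i) ∂histMeasure Δ) atTop
      (𝓝 0) := by
    simpa using tendsto_finsetSum Finset.univ fun i _ => hcomp i (fun s => g s i) (hg.eval i)
  rw [← tendsto_sub_nhds_zero_iff]
  refine key.congr fun k => ?_
  have hib : ∀ (φ : LInf n Δ) i, Integrable (fun s => g s i * φ s i) (histMeasure Δ) := fun φ i =>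
    (hg.eval i).mul_bdd (c := ‖φ‖) ((hev φ).eval i).aestronglyMeasurable
      ((ae_norm_le_norm φ).mono fun s hs => (norm_le_pi_norm _ i).trans hs)
  simp only [dotProduct, mul_sub]
  rw [integral_finsetSum _ fun i _ => hib (φ k) i, integral_finsetSum _ fun i _ => hib φ₀ i,
    ← Finset.sum_sub_distrib]
  exact Finset.sum_congr rfl fun i _ => integral_sub (hib _ i) (hib _ i)

/-- Lipschitz functions on an interval are primitives of bounded functions. -/
theorem exists_density_of_lipschitz {Δ : ℝ} {C : NNReal} {V : ℝ → Vec n}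
    (hV : LipschitzOnWith C V (Icc (-Δ) 0)) :
    ∃ φ : LInf n Δ, ‖φ‖ ≤ C ∧ ∀ t ∈ Icc (-Δ) 0, ∫ s in (-Δ)..t, φ s = V t - V (-Δ) := by
  have hVi : ∀ i, LipschitzOnWith C (fun s => V s i) (Icc (-Δ) 0) := fun i =>
    LipschitzOnWith.of_dist_le_mul fun s hs t ht =>
      (dist_le_pi_dist (V s) (V t) i).trans (hV.dist_le_mul s hs t ht)
  -- The density is the componentwise derivative: bounded by the Lipschitz constant at interior
  -- points, and integrating back to `V` by absolute continuity.
  set u : ℝ → Vec n := fun s i => deriv (fun s => V s i) s with hu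
  have hmeas : AEStronglyMeasurable u (histMeasure Δ) :=
    (measurable_pi_lambda _ fun i => measurable_deriv _).aestronglyMeasurable
  have hbd : ∀ᵐ s ∂histMeasure Δ, ‖u s‖ ≤ C := by
    rw [histMeasure, ← restrict_Ioo_eq_restrict_Icc]
    filter_upwards [ae_restrict_mem measurableSet_Ioo] with s hs
    refine (pi_norm_le_iff_of_nonneg C.2).2 fun i => ?_
    exact norm_deriv_le_of_lipschitzOn (Icc_mem_nhds hs.1 hs.2) (hVi i)
  have hmem : MemLp u ⊤ (histMeasure Δ) := memLp_top_of_bound hmeas C hbd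
  refine ⟨hmem.toLp u, norm_le_of_ae_le _ C.2 ?_, fun t ht => ?_⟩
  · filter_upwards [hmem.coeFn_toLp, hbd] with s h1 h2
    rwa [h1]
  · have hi : IntegrableOn u (Icc (-Δ) 0) := Integrable.of_bound hmeas C hbd
    have hsub : Ioc (-Δ) t ⊆ Icc (-Δ) 0 := Ioc_subset_Icc_self.trans (Icc_subset_Icc le_rfl ht.2)
    have e : ∫ s in (-Δ)..t, hmem.toLp u s = ∫ s in (-Δ)..t, u s := by
      refine intervalIntegral.integral_congr_ae ?_
      filter_upwards [(ae_restrict_iff' measurableSet_Icc).1 hmem.coeFn_toLp] with s hs hs'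
      rw [uIoc_of_le ht.1] at hs'
      exact hs (hsub hs')
    rw [e]
    funext i
    have hac : AbsolutelyContinuousOnInterval (fun s => V s i) (-Δ) t := by
      refine LipschitzOnWith.absolutelyContinuousOnInterval (K := C) ?_
      rw [uIcc_of_le ht.1]
      exact (hVi i).mono (Icc_subset_Icc le_rfl ht.2)
    rw [Pi.sub_apply, ← hac.integral_deriv_eq_sub, intervalIntegral.integral_of_le ht.1,
      intervalIntegral.integral_of_le ht.1]
    exact eval_integral (fun j => (hi.mono_set hsub).eval j) i

/-- Bounded sequences in `L^∞` have weak-* convergent subsequences. -/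
theorem exists_subseq_weakStarTendsto {Δ R : ℝ} (hΔ : 0 ≤ Δ) (φ : ℕ → LInf n Δ)
    (hR : ∀ k, ‖φ k‖ ≤ R) :
    ∃ σ : ℕ → ℕ, StrictMono σ ∧ ∃ φ₀ : LInf n Δ, ‖φ₀‖ ≤ R ∧
      WeakStarTendsto (fun k => φ (σ k)) φ₀ := by
  have hR0 : 0 ≤ R := (norm_nonneg _).trans (hR 0)
  have hi : ∀ k, ∀ s ∈ Icc (-Δ) 0, ∀ t ∈ Icc (-Δ) 0, IntervalIntegrable (φ k) volume s t := by
    intro k s hs t ht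
    have : IntegrableOn (φ k) (Icc (-Δ) 0) :=
      Integrable.of_bound (Lp.aestronglyMeasurable _) _ (ae_norm_le_norm (φ k))
    exact (this.mono_set (uIcc_subset_Icc hs ht)).intervalIntegrable
  have h0 : -Δ ∈ Icc (-Δ) 0 := ⟨le_rfl, by linarith⟩
  -- Arzelà–Ascoli is applied to the primitives; the density of their uniform limit is the weak-*
  -- limit.
  have hlip : ∀ k, LipschitzOnWith R.toNNReal (fun t => ∫ s in (-Δ)..t, φ k s) (Icc (-Δ) 0) := by
    refine fun k => LipschitzOnWith.of_dist_le_mul fun s hs t ht => ?_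
    rw [dist_eq_norm, intervalIntegral.integral_interval_sub_left (hi k _ h0 s hs) (hi k _ h0 t ht),
      Real.coe_toNNReal R hR0, Real.dist_eq]
    refine intervalIntegral.norm_integral_le_of_norm_le_const_ae ?_
    filter_upwards [(ae_restrict_iff' measurableSet_Icc).1 (ae_norm_le_norm (φ k))] with r hr hr'
    exact (hr (uIcc_subset_Icc ht hs (uIoc_subset_uIcc hr'))).trans (hR k)
  have hbd : ∀ k, ∀ t ∈ Icc (-Δ) 0, ‖∫ s in (-Δ)..t, φ k s‖ ≤ R * Δ := by
    intro k t ht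
    have h1 := (hlip k).dist_le_mul t ht _ h0
    rw [intervalIntegral.integral_same, dist_zero_right, Real.coe_toNNReal R hR0, Real.dist_eq,
      abs_of_nonneg (by linarith [ht.1])] at h1
    exact h1.trans (mul_le_mul_of_nonneg_left (by linarith [ht.2]) hR0)
  obtain ⟨σ, hσ, V, hV⟩ := exists_subseq_tendstoUniformlyOn (by linarith) hlip hbd
  obtain ⟨φ₀, hφ₀, hint⟩ := exists_density_of_lipschitz
    (LipschitzOnWith.of_tendstoUniformlyOn (fun k => hlip (σ k)) hV)
  rw [Real.coe_toNNReal R hR0] at hφ₀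
  refine ⟨σ, hσ, φ₀, hφ₀, weakStarTendsto_of_primitives (fun k => hR (σ k)) fun t ht => ?_⟩
  have hV0 : V (-Δ) = 0 :=
    tendsto_nhds_unique (hV.tendsto_at h0) (by simp)
  rw [hint t ht, hV0, sub_zero]
  exact hV.tendsto_at ht

/-! ### Continuous approximation of histories -/

/-- Approximation of essentially bounded functions by continuous ones with the same bound and the
same value at `0`. -/
theorem exists_continuous_approx {Δ R : ℝ} {ψ : ℝ → Vec n} (hψ : EssBddOn (-Δ) 0 R ψ)
    (hψ0 : ‖ψ 0‖ ≤ R) :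
    ∃ χ : ℕ → ℝ → Vec n, (∀ k, Continuous (χ k)) ∧ (∀ k s, ‖χ k s‖ ≤ R) ∧ (∀ k, χ k 0 = ψ 0) ∧
      ∀ᵐ s ∂histMeasure Δ, Tendsto (fun k => χ k s) atTop (𝓝 (ψ s)) := by
  have hR0 : 0 ≤ R := (norm_nonneg _).trans hψ0
  -- Extending by the constant `ψ 0` on `(0, 1]` makes every forward average over a step of length
  -- at most `1` equal to `ψ 0` at `0`.
  set w : ℝ → Vec n := fun s =>
    (Icc (-Δ) 0).indicator ψ s + (Ioc 0 1).indicator (fun _ => ψ 0) s with hw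
  have hwi : Integrable w volume := by
    refine Integrable.add ?_ ?_
    · exact IntegrableOn.integrable_indicator (Integrable.of_bound hψ.aesm R hψ.bound)
        measurableSet_Icc
    · exact IntegrableOn.integrable_indicator (integrableOn_const (by simp)) measurableSet_Ioc
  have hwR : ∀ᵐ s, ‖w s‖ ≤ R := by
    filter_upwards [(ae_restrict_iff' measurableSet_Icc).1 hψ.bound] with s hs
    by_cases h1 : s ∈ Icc (-Δ) 0
    · have h2 : s ∉ Ioc (0 : ℝ) 1 := fun h => h.1.not_ge h1.2
      simpa [hw, h1, h2] using hs h1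
    · by_cases h2 : s ∈ Ioc (0 : ℝ) 1
      · simpa only [hw, indicator_of_notMem h1, indicator_of_mem h2, zero_add] using hψ0
      · simpa only [hw, indicator_of_notMem h1, indicator_of_notMem h2, zero_add, norm_zero] using hR0
  set Φ : ℝ → Vec n := fun t => ∫ s in (0 : ℝ)..t, w s with hΦ
  have hΦc : Continuous Φ := intervalIntegral.continuous_primitive
    (fun _ _ => hwi.intervalIntegrable) 0
  set h : ℕ → ℝ := fun k => 1 / ((k : ℝ) + 1) with hh
  have hhp : ∀ k, 0 < h k := fun k => by positivity
  have hsub : ∀ s k, Φ (s + h k) - Φ s = ∫ r in s..(s + h k), w r := fun s k =>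
    intervalIntegral.integral_interval_sub_left hwi.intervalIntegrable hwi.intervalIntegrable
  -- Forward averages keep the bound `R`, and converge almost everywhere by Lebesgue
  -- differentiation.
  refine ⟨fun k s => (h k)⁻¹ • (Φ (s + h k) - Φ s), fun k => by fun_prop, fun k s => ?_,
    fun k => ?_, ?_⟩
  · simp only [hsub]
    rw [norm_smul, norm_inv, Real.norm_of_nonneg (hhp k).le, inv_mul_le_iff₀ (hhp k), mul_comm]
    have := intervalIntegral.norm_integral_le_of_norm_le_const_ae (f := w) (a := s) (b := s + h k)
      (hwR.mono fun r hr _ => hr)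
    rwa [add_sub_cancel_left, abs_of_pos (hhp k)] at this
  · have e : ∫ r in (0 : ℝ)..(0 + h k), w r = ∫ _r in (0 : ℝ)..(0 + h k), ψ 0 := by
      refine intervalIntegral.integral_congr_ae (Eventually.of_forall fun r hr => ?_)
      rw [uIoc_of_le (by linarith [hhp k])] at hr
      have hk1 : h k ≤ 1 := by
        simp only [hh]
        rw [div_le_one (by positivity)]
        have : (0 : ℝ) ≤ k := k.cast_nonneg
        linarith
      have h1 : r ∉ Icc (-Δ) 0 := fun h => hr.1.not_ge h.2
      have h2 : r ∈ Ioc (0 : ℝ) 1 := ⟨hr.1, by linarith [hr.2]⟩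
      simp only [hw, indicator_of_notMem h1, indicator_of_mem h2, zero_add]
    simp only [hsub]
    rw [e, intervalIntegral.integral_const, zero_add, sub_zero, smul_smul,
      inv_mul_cancel₀ (hhp k).ne', one_smul]
  · have hne : ∀ᵐ r ∂histMeasure Δ, r ∈ Icc (-Δ) 0 := ae_restrict_mem measurableSet_Icc
    filter_upwards [ae_restrict_of_ae (LocallyIntegrable.ae_hasDerivAt_integral
      hwi.locallyIntegrable), hne] with s hs hs'
    have h2 : s ∉ Ioc (0 : ℝ) 1 := fun h => h.1.not_ge hs'.2
    have hws : w s = ψ s := by simp [hw, hs', h2]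
    have h3 := hasDerivAt_iff_tendsto_slope_zero.1 (hs 0)
    rw [hws] at h3
    refine h3.comp (tendsto_nhdsWithin_iff.2 ⟨tendsto_one_div_add_atTop_nhds_zero_nat,
      Eventually.of_forall fun k => (hhp k).ne'⟩)

/-! ### From forward completeness to bounded reachability -/

theorem ForwardCompleteOn.exists_solution {S : Set (Vec n × LInf n (maxDelay τ))}
    (h : ForwardCompleteOn τ f S) {a : ℝ} (ha : 0 ≤ a) {p : Vec n × LInf n (maxDelay τ)}
    (hp : p ∈ S) : ∃ ψ x : ℝ → Vec n, ψ =ᵐ[histMeasure (maxDelay τ)] p.2 ∧ ψ 0 = p.1 ∧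
      (∀ b, a ≤ b → SolvesOn τ f a b ψ x) ∧ IsMaximalSolutionFrom τ f a p.1 p.2 (Ici a) x := by
  obtain ⟨⟨J, x, hx⟩, hJ⟩ := h a ha p hp
  obtain rfl := hJ J x hx
  obtain ⟨ψ, -, hae, h0, hmax⟩ := id hx
  exact ⟨ψ, x, hae, h0, fun b hb => hmax.1.solvesOn hb, hx⟩

theorem SolvesOn.shift (hτ0 : τ 0 = 0) (hτ : StrictMono τ) (hf : UniformlyRegular τ {f})
    {a b c R : ℝ} {ψ x : ℝ → Vec n} (ha : 0 ≤ a) (hac : a ≤ c) (hψ : EssBddOn (-maxDelay τ) 0 R ψ)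
    (hx : SolvesOn τ f a b ψ x) : SolvesOn τ f c b (fun s => concat a ψ x (c + s)) x := by
  refine ⟨hx.cont.mono (Icc_subset_Icc hac le_rfl), fun t ht => ?_⟩
  have i1 := intervalIntegrable_vectorField hτ0 hτ hf ha hac hψ
    (hx.cont.mono (Icc_subset_Icc le_rfl (ht.1.trans ht.2)))
  have i2 := intervalIntegrable_vectorField hτ0 hτ hf ha (hac.trans ht.1) hψ
    (hx.cont.mono (Icc_subset_Icc le_rfl ht.2))
  rw [concat_shift hac, hx.eq_integral t ⟨hac.trans ht.1, ht.2⟩,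
    ← intervalIntegral.integral_add_adjacent_intervals i1 (i1.symm.trans i2), ← add_assoc,
    ← hx.eq_integral c ⟨hac, ht.1.trans ht.2⟩, add_zero, concat_of_ge hac]

/-- At the first time where `d` reaches `1` the bound `d ≤ 1` still holds up to that time, so the
hypothesis improves it to `1 / 2` there, a contradiction. -/
theorem le_one_of_bootstrap {d : ℝ → ℝ} {a b : ℝ} (hd : ContinuousOn d (Icc a b)) (ha : d a < 1)
    (h : ∀ c ∈ Icc a b, (∀ t ∈ Icc a c, d t ≤ 1) → d c ≤ 1 / 2) : ∀ t ∈ Icc a b, d t ≤ 1 := by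
  by_contra! hcon
  obtain ⟨t₀, ht₀, hdt₀⟩ := hcon
  have hK : IsCompact (Icc a b ∩ d ⁻¹' Ici 1) :=
    isCompact_Icc.of_isClosed_subset
      (hd.preimage_isClosed_of_isClosed isClosed_Icc isClosed_Ici) inter_subset_left
  obtain ⟨c, ⟨hc, hc1⟩, hmin⟩ := hK.exists_isLeast ⟨t₀, ht₀, hdt₀.le⟩
  have hlt : ∀ t ∈ Icc a b, t < c → d t < 1 := fun t ht htc => by
    by_contra! hge
    exact htc.not_ge (hmin ⟨ht, hge⟩)
  have hc2 : d c ≤ 1 := by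
    by_contra! hgt
    obtain ⟨t, ht, hdt⟩ := intermediate_value_Icc hc.1 (hd.mono (Icc_subset_Icc le_rfl hc.2))
      ⟨ha.le, hgt.le⟩
    have htc : t ≠ c := fun e => by rw [e] at hdt; linarith
    exact (hlt t ⟨ht.1, ht.2.trans hc.2⟩ (lt_of_le_of_ne ht.2 htc)).ne hdt
  have := h c hc fun t ht => by
    rcases ht.2.eq_or_lt with rfl | htc
    · exact hc2
    · exact (hlt t ⟨ht.1, ht.2.trans hc.2⟩ htc).le
  have hc1' : 1 ≤ d c := hc1
  linarith

/-- Compactness and contradiction: a limit of the data of ever larger solutions has a bounded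
solution on the window, and closeness to it bounds solutions far along the subsequence. -/
theorem exists_bound_maxDelay (hℓ : 1 ≤ ℓ) (hτ0 : τ 0 = 0) (hτ : StrictMono τ)
    (hf : WeakStarRegular τ {f}) (hFC : ForwardCompleteOn τ f univ) {a R : ℝ} (ha : 0 ≤ a)
    (hR : 0 < R) :
    ∃ M : ℝ, ∀ (ψ x : ℝ → Vec n) (φ : LInf n (maxDelay τ)), ψ =ᵐ[histMeasure (maxDelay τ)] φ →
      ‖φ‖ ≤ R → ‖ψ 0‖ ≤ R → SolvesOn τ f a (a + maxDelay τ) ψ x →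
      ∀ t ∈ Icc a (a + maxDelay τ), ‖x t‖ ≤ M := by
  by_contra! hcon
  have hΔ := maxDelay_pos hℓ hτ0 hτ
  choose ψ x φ hψφ hφ hψ0 hsol t ht hlarge using fun k : ℕ => hcon k
  obtain ⟨ξ₀, -, σ₁, hσ₁, hξ⟩ := (isCompact_closedBall (0 : Vec n) R).tendsto_subseq
    (x := fun k => ψ k 0) (fun k => mem_closedBall_zero_iff.2 (hψ0 k))
  obtain ⟨σ₂, hσ₂, φ₀, hφ₀, hweak⟩ := exists_subseq_weakStarTendsto hΔ.le (fun k => φ (σ₁ k))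
    fun k => hφ _
  obtain ⟨ψ₀, x₀, hψ₀, hψ₀0, hsol₀, -⟩ := hFC.exists_solution ha (mem_univ (ξ₀, φ₀))
  replace hsol₀ := hsol₀ (a + maxDelay τ) (by linarith)
  set b := a + maxDelay τ
  have hab : a < b := by simp only [b]; linarith
  set σ := fun k => σ₁ (σ₂ k)
  have hξσ : Tendsto (fun k => ψ (σ k) 0) atTop (𝓝 ξ₀) := hξ.comp hσ₂.tendsto_atTop
  obtain ⟨M₀, hM₀⟩ := isCompact_Icc.exists_bound_of_continuousOn hsol₀.cont
  -- The Lipschitz constant must be valid on a tube of radius `1` about the limit solution; the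
  -- bootstrap keeps the other solutions inside.
  set R' := max R (M₀ + 1) with hR'
  have hRR' : R ≤ R' := le_max_left _ _
  have hMR' : M₀ + 1 ≤ R' := le_max_right _ _
  obtain ⟨C, hC, hgron⟩ := exists_gronwall hτ0 hτ hf.regular (R := R') (T := b)
    (hR.trans_le hRR') (by linarith)
  -- Initial value and integrated field each contribute an error at most `ε`, and `C * (ε + ε) = 1 /
  -- 2` closes the bootstrap.
  set ε := 1 / (4 * C) with hε
  have hε0 : 0 < ε := by positivity
  obtain ⟨j₁, hj₁⟩ := hf.tendsto_integral hℓ hτ0 hτ (R := R') (x := x₀) (ψ := fun k => ψ (σ k))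
    (φ := fun k => φ (σ k)) ha (hR.trans_le hRR') hε0 (fun k => hψφ _) hψ₀ hsol₀.cont
    (fun t ht => (hM₀ t ht).trans (by linarith)) (fun k => (hφ _).trans hRR') (hφ₀.trans hRR') hweak
  obtain ⟨j₂, hj₂⟩ := Metric.tendsto_atTop.1 hξσ (min 1 ε) (lt_min one_pos hε0)
  obtain ⟨j₃, hj₃⟩ := exists_nat_ge (M₀ + 1)
  set k := max (max j₁ j₂) j₃
  have hk₁ : j₁ ≤ k := (le_max_left _ _).trans (le_max_left _ _)
  have hk₂ : j₂ ≤ k := (le_max_right _ _).trans (le_max_left _ _)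
  have hk₃ : j₃ ≤ k := le_max_right _ _
  have hξk := hj₂ k hk₂
  rw [dist_eq_norm, lt_min_iff] at hξk
  have hbd : EssBddOn (-maxDelay τ) 0 R' (ψ (σ k)) :=
    essBddOn_of_ae_eq (hψφ _) ((hφ _).trans hRR')
  have hbd₀ : EssBddOn (-maxDelay τ) 0 R' ψ₀ := essBddOn_of_ae_eq hψ₀ (hφ₀.trans hRR')
  have hclose : ∀ t ∈ Icc a b, ‖x (σ k) t - x₀ t‖ ≤ 1 := by
    refine le_one_of_bootstrap ((hsol (σ k)).cont.sub hsol₀.cont).norm ?_ fun c hc hle => ?_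
    · rw [(hsol (σ k)).apply_left hab.le, hsol₀.apply_left hab.le, hψ₀0]
      exact hξk.1
    have hsub := Icc_subset_Icc (le_refl a) hc.2
    have hxk : ∀ t ∈ Icc a c, ‖x (σ k) t‖ ≤ R' := fun t ht => by
      have h1 := norm_le_norm_add_norm_sub' (x (σ k) t) (x₀ t)
      linarith [hle t ht, hM₀ t (hsub ht)]
    have := hgron (ψ (σ k)) (x (σ k)) x₀ a c (‖ψ (σ k) 0 - ξ₀‖ + ε) ha hc.2 (by positivity) hbd
      ((hsol (σ k)).cont.mono hsub) (hsol₀.cont.mono hsub) hxk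
      (fun t ht => (hM₀ t (hsub ht)).trans (by linarith)) (fun t ht => ?_) c ⟨hc.1, le_rfl⟩
    · refine this.trans ?_
      have h2 : C * (‖ψ (σ k) 0 - ξ₀‖ + ε) ≤ C * (ε + ε) :=
        mul_le_mul_of_nonneg_left (by linarith [hξk.2]) hC.le
      have h3 : C * (ε + ε) = 1 / 2 := by rw [hε]; field_simp; norm_num
      linarith
    · have ht' := hsub ht
      have hsub' := Icc_subset_Icc (le_refl a) ht'.2
      have i1 := intervalIntegrable_vectorField hτ0 hτ hf.regular ha ht.1 hbd
        ((hsol (σ k)).cont.mono hsub')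
      have i2 := intervalIntegrable_vectorField hτ0 hτ hf.regular ha ht.1 hbd (hsol₀.cont.mono hsub')
      have i3 := intervalIntegrable_vectorField hτ0 hτ hf.regular ha ht.1 hbd₀
        (hsol₀.cont.mono hsub')
      have hsmall := hj₁ k hk₁ t ht'
      rw [intervalIntegral.integral_sub i2 i3] at hsmall
      rw [(hsol (σ k)).eq_integral t ht', hsol₀.eq_integral t ht', hψ₀0,
        intervalIntegral.integral_sub i1 i2]
      -- `I₂` combines the `k`-th history with the limit continuation: `I₂ - I₃` is small by weak-*
      -- continuity, and `I₁ - I₂` is left to Gronwall.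
      set I₁ := ∫ s in a..t, vectorField τ f (concat a (ψ (σ k)) (x (σ k))) s
      set I₂ := ∫ s in a..t, vectorField τ f (concat a (ψ (σ k)) x₀) s
      set I₃ := ∫ s in a..t, vectorField τ f (concat a ψ₀ x₀) s
      calc ‖ψ (σ k) 0 + I₁ - (ξ₀ + I₃)‖ = ‖(ψ (σ k) 0 - ξ₀) + (I₂ - I₃) + (I₁ - I₂)‖ := by
            congr 1; abel
        _ ≤ ‖ψ (σ k) 0 - ξ₀‖ + ‖I₂ - I₃‖ + ‖I₁ - I₂‖ := norm_add₃_le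
        _ ≤ ‖ψ (σ k) 0 - ξ₀‖ + ε + ‖I₁ - I₂‖ := by gcongr
  have h1 := hclose _ (ht (σ k))
  have h2 := norm_le_norm_add_norm_sub' (x (σ k) (t (σ k))) (x₀ (t (σ k)))
  have h3 := hM₀ _ (ht (σ k))
  have h4 : (k : ℝ) ≤ σ k := Nat.cast_le.2 ((hσ₂.le_apply).trans hσ₁.le_apply)
  have h5 : (j₃ : ℝ) ≤ k := Nat.cast_le.2 hk₃
  linarith [hlarge (σ k)]

/-- A bound on one window controls both the value and the history at its end, so the one-window
estimate can be restarted there with a larger radius. -/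
theorem exists_bound_mul_maxDelay (hℓ : 1 ≤ ℓ) (hτ0 : τ 0 = 0) (hτ : StrictMono τ)
    (hf : WeakStarRegular τ {f}) (hFC : ForwardCompleteOn τ f univ) (N : ℕ) {a R : ℝ} (ha : 0 ≤ a)
    (hR : 0 < R) :
    ∃ M : ℝ, ∀ (ψ x : ℝ → Vec n) (φ : LInf n (maxDelay τ)), ψ =ᵐ[histMeasure (maxDelay τ)] φ →
      ‖φ‖ ≤ R → ‖ψ 0‖ ≤ R → (∀ b, a ≤ b → SolvesOn τ f a b ψ x) →
      ∀ t ∈ Icc a (a + N * maxDelay τ), ‖x t‖ ≤ M := by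
  have hΔ := maxDelay_pos hℓ hτ0 hτ
  induction N generalizing a R with
  | zero =>
    refine ⟨R, fun ψ x φ _ _ hψ0 hx t ht => ?_⟩
    have hta : t = a := le_antisymm (by simpa using ht.2) ht.1
    rwa [hta, (hx a le_rfl).apply_left le_rfl]
  | succ N ih =>
    obtain ⟨M₁, hM₁⟩ := exists_bound_maxDelay hℓ hτ0 hτ hf hFC ha hR
    have hc : a ≤ a + maxDelay τ := by linarith
    obtain ⟨M₂, hM₂⟩ := ih (a := a + maxDelay τ) (R := max R M₁) (by linarith)
      (hR.trans_le (le_max_left _ _))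
    refine ⟨max M₁ M₂, fun ψ x φ hψ hφ hψ0 hx t ht => ?_⟩
    have hbd₁ := hM₁ ψ x φ hψ hφ hψ0 (hx _ hc)
    rcases le_total t (a + maxDelay τ) with htc | htc
    · exact (hbd₁ t ⟨ht.1, htc⟩).trans (le_max_left _ _)
    · refine le_trans ?_ (le_max_right _ _)
      have hE := essBddOn_of_ae_eq hψ hφ
      have hX : EssBddOn (a - maxDelay τ) (a + maxDelay τ) (max R M₁) (concat a ψ x) :=
        (hE.mono le_rfl le_rfl (le_max_left _ _)).concat (hx _ hc).cont
          fun t ht => (hbd₁ t ht).trans (le_max_right _ _)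
      have hX' := hX.mono (c := a + maxDelay τ - maxDelay τ) (by linarith) le_rfl le_rfl
      refine hM₂ (fun s => concat a ψ x (a + maxDelay τ + s)) x
        (segment (maxDelay τ) (concat a ψ x) (a + maxDelay τ)) hX'.coeFn_segment.symm
        (hX'.norm_segment_le (hR.le.trans (le_max_left _ _))) ?_
        (fun b hb => (hx b (hc.trans hb)).shift hτ0 hτ hf.regular ha hc hE) t ⟨htc, ?_⟩
      · simp only [add_zero, concat_of_ge hc]
        exact (hbd₁ _ ⟨hc, le_rfl⟩).trans (le_max_right _ _)
      · have := ht.2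
        push_cast at this
        linarith

theorem boundedReachabilitySetsOn_of_forwardCompleteOn (hℓ : 1 ≤ ℓ) (hτ0 : τ 0 = 0)
    (hτ : StrictMono τ) (hf : WeakStarRegular τ {f}) (hFC : ForwardCompleteOn τ f univ)
    (S : Set (Vec n × LInf n (maxDelay τ))) : BoundedReachabilitySetsOn τ f S := by
  refine ⟨fun a ha p _ => hFC a ha p (mem_univ p), fun a T R ha _ hR => ?_⟩
  have hΔ := maxDelay_pos hℓ hτ0 hτ
  obtain ⟨N, hN⟩ := exists_nat_ge ((T - a) / maxDelay τ)
  rw [div_le_iff₀ hΔ] at hN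
  obtain ⟨M, hM⟩ := exists_bound_mul_maxDelay hℓ hτ0 hτ hf hFC N ha hR
  refine ⟨M, ?_⟩
  rintro _ ⟨p, -, hp1, hp2, J, x, hx, t, ⟨ht, -⟩, rfl⟩
  obtain rfl := (hFC a ha p (mem_univ p)).2 J x hx
  obtain ⟨ψ, -, hae, h0, hmax⟩ := hx
  exact hM ψ x p.2 hae hp2 (h0 ▸ hp1) (fun b hb => hmax.1.solvesOn hb) t
    ⟨ht.1, by linarith [ht.2]⟩

/-! ### From bounded reachability for continuous data to forward completeness -/

/-- A uniform limit of solutions with weak-* convergent histories is a solution. -/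
theorem SolvesOn.of_tendstoUniformlyOn (hℓ : 1 ≤ ℓ) (hτ0 : τ 0 = 0) (hτ : StrictMono τ)
    (hf : WeakStarRegular τ {f}) {a R : ℝ} {ψ x : ℕ → ℝ → Vec n} {ψ₀ v : ℝ → Vec n}
    {φ : ℕ → LInf n (maxDelay τ)} {φ₀ : LInf n (maxDelay τ)} (ha : 0 ≤ a) (hR : 0 < R)
    (hψ : ∀ k, ψ k =ᵐ[histMeasure (maxDelay τ)] φ k) (hψ₀ : ψ₀ =ᵐ[histMeasure (maxDelay τ)] φ₀)
    (hψ0 : ∀ k, ψ k 0 = ψ₀ 0) (hφ : ∀ k, ‖φ k‖ ≤ R) (hφ₀ : ‖φ₀‖ ≤ R)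
    (h : WeakStarTendsto φ φ₀) (hx : ∀ k, SolvesOn τ f a (a + maxDelay τ) (ψ k) (x k))
    (hxR : ∀ k, ∀ t ∈ Icc a (a + maxDelay τ), ‖x k t‖ ≤ R)
    (hv : TendstoUniformlyOn x v atTop (Icc a (a + maxDelay τ))) :
    SolvesOn τ f a (a + maxDelay τ) ψ₀ v := by
  have hΔ := maxDelay_pos hℓ hτ0 hτ
  set b := a + maxDelay τ with hb
  have hvc : ContinuousOn v (Icc a b) :=
    hv.continuousOn (Frequently.of_forall fun k => (hx k).cont)
  have hvR : ∀ t ∈ Icc a b, ‖v t‖ ≤ R := fun t ht =>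
    le_of_tendsto (hv.tendsto_at ht).norm (Eventually.of_forall fun k => hxR k t ht)
  obtain ⟨L, hL, hlip⟩ := exists_vectorField_lipschitz hτ0 hτ hf.regular (T := b) hR (by linarith)
  refine ⟨hvc, fun t ht => eq_of_forall_dist_le fun ε hε => ?_⟩
  -- Chosen so that the uniform error `η` and the resulting Lipschitz error `L * η * maxDelay τ` add
  -- up to `ε / 2`.
  set η := ε / (2 * (1 + L * maxDelay τ)) with hη
  have hη0 : 0 < η := by positivity
  obtain ⟨j, hj⟩ := hf.tendsto_integral hℓ hτ0 hτ ha hR (half_pos hε) hψ hψ₀ hvc hvR hφ hφ₀ h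
  obtain ⟨k, hkj, hk⟩ := ((eventually_ge_atTop j).and
    (Metric.tendstoUniformlyOn_iff.1 hv η hη0)).exists
  have hsub := Icc_subset_Icc (le_refl a) ht.2
  have hE := essBddOn_of_ae_eq (hψ k) (hφ k)
  have i1 := intervalIntegrable_vectorField hτ0 hτ hf.regular ha ht.1 hE ((hx k).cont.mono hsub)
  have i2 := intervalIntegrable_vectorField hτ0 hτ hf.regular ha ht.1 hE (hvc.mono hsub)
  have i3 := intervalIntegrable_vectorField hτ0 hτ hf.regular ha ht.1
    (essBddOn_of_ae_eq hψ₀ hφ₀) (hvc.mono hsub)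
  have h1 := hj k hkj t ht
  have hdist : ∀ r ∈ Icc a b, ‖x k r - v r‖ ≤ η := fun r hr => by
    rw [← dist_eq_norm, dist_comm]; exact (hk r hr).le
  have h2 : ‖∫ s in a..t, (vectorField τ f (concat a (ψ k) (x k)) s -
      vectorField τ f (concat a (ψ k) v) s)‖ ≤ L * η * |t - a| := by
    refine intervalIntegral.norm_integral_le_of_norm_le_const_ae ?_
    have := hlip (concat a (ψ k) (x k)) (concat a (ψ k) v) (fun _ => η) a b ha le_rfl
      (hE.concat (hx k).cont (hxR k)) (hE.concat hvc hvR) monotone_const (fun _ => hη0.le)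
      (ae_restrict_concat (Eventually.of_forall fun r hr => by
        rw [concat_of_lt hr, concat_of_lt hr, sub_self, norm_zero]; exact hη0.le)
        fun r hr => by rw [concat_of_ge hr.1, concat_of_ge hr.1]; exact hdist r hr)
    filter_upwards [(ae_restrict_iff' measurableSet_Icc).1 this] with s hs hs'
    rw [uIoc_of_le ht.1] at hs'
    exact hs ⟨hs'.1.le, hs'.2.trans ht.2⟩
  have h3 : L * η * |t - a| ≤ L * η * maxDelay τ := by
    rw [abs_of_nonneg (by linarith [ht.1])]
    exact mul_le_mul_of_nonneg_left (by linarith [ht.2]) (by positivity)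
  rw [intervalIntegral.integral_sub i2 i3] at h1
  rw [intervalIntegral.integral_sub i1 i2] at h2
  have h4 : ‖v t - x k t‖ ≤ η := by rw [norm_sub_rev]; exact hdist t ht
  have h5 := (hx k).eq_integral t ht
  rw [hψ0] at h5
  set I₁ := ∫ s in a..t, vectorField τ f (concat a (ψ k) (x k)) s
  set I₂ := ∫ s in a..t, vectorField τ f (concat a (ψ k) v) s
  set I₃ := ∫ s in a..t, vectorField τ f (concat a ψ₀ v) s
  have h6 : η + L * η * maxDelay τ = ε / 2 := by rw [hη]; field_simp
  calc dist (v t) (ψ₀ 0 + I₃) = ‖(v t - x k t) + (I₁ - I₂) + (I₂ - I₃)‖ := by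
        rw [dist_eq_norm, h5]; congr 1; abel
    _ ≤ ‖v t - x k t‖ + ‖I₁ - I₂‖ + ‖I₂ - I₃‖ := norm_add₃_le
    _ ≤ ε := by linarith

/-- Boundedness of reachability sets supplies the common bound for the solutions of the
approximating continuous problems, without which no uniform limit could be extracted. -/
theorem BoundedReachabilitySetsOn.exists_solution_maxDelay (hℓ : 1 ≤ ℓ) (hτ0 : τ 0 = 0)
    (hτ : StrictMono τ) (hf : WeakStarRegular τ {f})
    (hB : BoundedReachabilitySetsOn τ f (continuousIC n (maxDelay τ))) {a : ℝ} {ψ : ℝ → Vec n}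
    (ha : 0 ≤ a) (hψ : MemCalLInf (maxDelay τ) ψ) :
    ∃ v, SolvesOn τ f a (a + maxDelay τ) ψ v := by
  have hΔ := maxDelay_pos hℓ hτ0 hτ
  obtain ⟨R₀, hR₀⟩ := hψ.exists_essBddOn
  set R := max 1 (max R₀ ‖ψ 0‖) with hR
  have hR1 : 0 < R := lt_of_lt_of_le one_pos (le_max_left _ _)
  have hψR : EssBddOn (-maxDelay τ) 0 R ψ := hR₀.mono le_rfl le_rfl (by simp [hR])
  obtain ⟨χ, hχc, hχR, hχ0, hχψ⟩ := exists_continuous_approx hψR (by simp [hR])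
  have hχm : ∀ k, MemLp (χ k) ⊤ (histMeasure (maxDelay τ)) := fun k =>
    memLp_top_of_bound (hχc k).aestronglyMeasurable R (Eventually.of_forall (hχR k))
  set φ : ℕ → LInf n (maxDelay τ) := fun k => (hχm k).toLp (χ k)
  set φ₀ : LInf n (maxDelay τ) := hψ.toLp ψ
  have hφχ : ∀ k, φ k =ᵐ[histMeasure (maxDelay τ)] χ k := fun k => (hχm k).coeFn_toLp
  have hφψ : φ₀ =ᵐ[histMeasure (maxDelay τ)] ψ := hψ.coeFn_toLp
  have hφR : ∀ k, ‖φ k‖ ≤ R := fun k => norm_le_of_ae_le _ hR1.le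
    ((hφχ k).mono fun s hs => by rw [hs]; exact hχR k s)
  have hφ₀R : ‖φ₀‖ ≤ R := norm_le_of_ae_le _ hR1.le (by
    filter_upwards [hφψ, hψR.bound] with s h1 h2
    rwa [h1])
  have hweak : WeakStarTendsto φ φ₀ := by
    refine weakStarTendsto_of_ae_tendsto hφR ?_
    filter_upwards [ae_all_iff.2 hφχ, hφψ, hχψ] with s h1 h2 h3
    simpa only [h1, h2] using h3
  have hIC : ∀ k, (ψ 0, φ k) ∈ continuousIC n (maxDelay τ) := fun k =>
    ⟨χ k, (hχc k).continuousOn, (hφχ k).symm, hχ0 k⟩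
  choose ω x hω hω0 hx hmax using fun k => hB.1.exists_solution ha (hIC k)
  have hab : a < a + maxDelay τ := by linarith
  obtain ⟨M, hM⟩ := hB.2 a (a + maxDelay τ) R ha hab hR1
  have hxM : ∀ k, ∀ t ∈ Icc a (a + maxDelay τ), ‖x k t‖ ≤ max R M := fun k t ht =>
    (hM ⟨(ψ 0, φ k), hIC k, by simp [hR], hφR k, Ici a, x k, hmax k, t, ⟨ht, ht.1⟩, rfl⟩).trans
      (le_max_right _ _)
  have hR' : 0 < max R M := hR1.trans_le (le_max_left _ _)
  obtain ⟨C, hC⟩ := exists_solution_lipschitz hτ0 hτ hf.regular (T := a + maxDelay τ) hR'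
    (by linarith)
  obtain ⟨σ, hσ, v, hv⟩ := exists_subseq_tendstoUniformlyOn hab.le
    (fun k => hC (ω k) (x k) a (a + maxDelay τ) ha le_rfl
      (essBddOn_of_ae_eq (hω k) ((hφR k).trans (le_max_left _ _))) (hx k _ hab.le) (hxM k)) hxM
  exact ⟨v, SolvesOn.of_tendstoUniformlyOn hℓ hτ0 hτ hf ha hR' (fun k => hω (σ k)) hφψ.symm
    (fun k => hω0 (σ k)) (fun k => (hφR _).trans (le_max_left _ _))
    (hφ₀R.trans (le_max_left _ _)) (fun g hg => (hweak g hg).comp hσ.tendsto_atTop)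
    (fun k => hx (σ k) _ hab.le) (fun k => hxM (σ k)) hv⟩

/-- One window suffices: a solution on it is continuous, so after one maximal delay the
discontinuous history is forgotten. -/
theorem forwardCompleteOn_of_boundedReachabilitySetsOn (hℓ : 1 ≤ ℓ) (hτ0 : τ 0 = 0)
    (hτ : StrictMono τ) (hf : WeakStarRegular τ {f})
    (hB : BoundedReachabilitySetsOn τ f (continuousIC n (maxDelay τ))) :
    ForwardCompleteOn τ f univ := by
  refine forwardCompleteOn_univ hτ0 hτ hf.regular fun a ψ ha hψ => ?_
  have hΔ := maxDelay_pos hℓ hτ0 hτ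
  obtain ⟨v, hv⟩ := hB.exists_solution_maxDelay hℓ hτ0 hτ hf ha hψ
  obtain ⟨R, hR⟩ := hψ.exists_essBddOn
  obtain ⟨M, hM⟩ := isCompact_Icc.exists_bound_of_continuousOn hv.cont
  set c := a + maxDelay τ with hc
  have hac : a ≤ c := by linarith
  have hX : EssBddOn (a - maxDelay τ) c (max R M) (concat a ψ v) :=
    (hR.mono le_rfl le_rfl (le_max_left _ _)).concat hv.cont
      fun t ht => (hM t ht).trans (le_max_right _ _)
  have hX' := hX.mono (c := c - maxDelay τ) (by linarith) le_rfl le_rfl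
  have hIC : (v c, segment (maxDelay τ) (concat a ψ v) c) ∈ continuousIC n (maxDelay τ) := by
    refine ⟨fun s => concat a ψ v (c + s), ?_, hX'.coeFn_segment.symm, ?_⟩
    · have hmaps : MapsTo (fun s => c + s) (Icc (-maxDelay τ) 0) (Icc a c) := fun s hs =>
        ⟨by linarith [hs.1], by linarith [hs.2]⟩
      refine (hv.cont.comp (by fun_prop) hmaps).congr fun s hs => ?_
      exact concat_of_ge (hmaps hs).1
    · simp only [add_zero, concat_of_ge hac]
  obtain ⟨χ, y, hχ, hχ0, hy, -⟩ := hB.1.exists_solution (ha.trans hac) hIC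
  refine ⟨fun t => if t < c then v t else y t, fun b _ => ?_⟩
  -- Gluing needs an end point not before `c`, so the solution is built up to `max b c` and
  -- restricted.
  exact (SolvesOn.glue hτ0 hτ hf.regular ha hac (le_max_right b c) hR hv
    (hy _ (le_max_right b c)) (hχ.trans hX'.coeFn_segment) hχ0).mono (le_max_left b c)

end DelaySystem

theorem corollary2 (n ℓ : ℕ) (hℓ : 1 ≤ ℓ) (τ : Fin (ℓ + 1) → ℝ) (hτ0 : τ 0 = 0)
    (hτ : StrictMono τ) (f : DelaySystem.RHS n ℓ (DelaySystem.maxDelay τ))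
    (hf : DelaySystem.WeakStarRegular τ {f}) :
    DelaySystem.BoundedReachabilitySetsOn τ f
        (DelaySystem.continuousIC n (DelaySystem.maxDelay τ)) ↔
      DelaySystem.ForwardCompleteOn τ f Set.univ :=
  ⟨DelaySystem.forwardCompleteOn_of_boundedReachabilitySetsOn hℓ hτ0 hτ hf,
    fun h => DelaySystem.boundedReachabilitySetsOn_of_forwardCompleteOn hℓ hτ0 hτ hf h _⟩
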